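/- Let $I_0(y)=\sum_{n\ge 0}\frac{(y/2)^{2n}}{(n!)^2}$ be the modified Bessel function of order $0$, let $\chi^*_{[-1,1]}$ be the normalized characteristic function of $[-1,1]$ (equal to $1$ on $(-1,1)$, to $1/2$ at $\pm1$ and to $0$ elsewhere), and let \[ \ell_c(t)=\frac{c}{\sinh c}\,\frac{\sin\sqrt{t^2-c^2}}{\sqrt{t^2-c^2}}\quad(t\in\mathbb C) \] be the (entire) Logan function. For $c>0$ and $\varepsilon>0$ put \[ \eta_c(y)=\chi^*_{[-1,1]}(y)\,\frac{c}{2\sinh c}\,I_0\bigl(c\sqrt{1-y^2}\bigr),\qquad \eta_{c,\varepsilon}(y)=\frac1\varepsilon\,\eta_c(y/\varepsilon),\qquad \lambda_{c,\varepsilon}=\ell_c(i\varepsilon/2), \] let $\mu_{c,\varepsilon}$ be the odd function with $\mu_{c,\varepsilon}(t)=-\int_{-\infty}^t\eta_{c,\varepsilon}(\tau)\,d\tau$ for $t<0$, $\mu_{c,\varepsilon}(0)=0$ and $\mu_{c,\varepsilon}(t)=-\mu_{c,\varepsilon}(-t)$ for $t>0$, let $\nu_{c,\varepsilon}(t)=\int_{-\infty}^t\mu_{c,\varepsilon}(\tau)\,d\tau$,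 and write $\mu_c=\mu_{c,1}$, $\nu_c=\nu_{c,1}$. Finally let \[ M_{x,c,\varepsilon}(t)=\lambda_{c,\varepsilon}^{-1}\Bigl[\mu_{c,\varepsilon}\bigl(\log\tfrac tx\bigr)+\Bigl(\frac1{\log t}-\frac12\Bigr)\Bigl(\mu_{c,\varepsilon}\bigl(\log\tfrac tx\bigr)\log\tfrac tx-\nu_{c,\varepsilon}\bigl(\log\tfrac tx\bigr)\Bigr)\Bigr]. \] Let $x\ge100$, $0<\varepsilon\le0.01$, $c\ge1$ and $\alpha\in(0,1)$ be real numbers such that \[ B:=\frac{\varepsilon\,x\,e^{-\varepsilon}\,|\nu_c(\alpha)|}{2\mu_c(\alpha)}>1, \] and let $I_\alpha^+=[e^{\alpha\varepsilon}x,\,e^{\varepsilon}x]$ and $I_\alpha^-=[e^{-\varepsilon}x,\,e^{-\alpha\varepsilon}x]$. Then, for each of the two intervals $I=I_\alpha^+$ and $I=I_\alpha^-$, the sum over all prime powers $p^m\in I$ ($p$ prime, $m\ge1$) satisfies \[ \Bigl|\sum_{p^m\in I}\frac1m\,M_{x,c,\varepsilon}(p^m)\Bigr|\le\frac{2\,\varepsilon\,x\,e^{2\varepsilon}\,|\nu_c(\alpha)|}{\log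 B}+e^{\varepsilon}\mu_c(\alpha)\bigl(4.01\,\varepsilon\sqrt x+\log\log(2x^2)\bigr). \] -/

import Mathlib

open MeasureTheory

noncomputable section

namespace LoganSieve

open Classical in
/-- The normalized characteristic function of a set `A` of real numbers: `1` on the interior of
`A`, `1/2` on the boundary of `A`, and `0` off the closure of `A`. -/
def chiStar (A : Set ℝ) (t : ℝ) : ℝ :=
  if t ∈ interior A then 1 else if t ∈ frontier A then 1 / 2 else 0

/-- The modified Bessel function of the first kind of order `0`. -/
def besselI0 (y : ℝ) : ℝ :=
  ∑' n : ℕ, (y / 2) ^ (2 * n) / ((n.factorial : ℝ) ^ 2)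

/-- The entire function `w ↦ sin w / w`. -/
def csinc (w : ℂ) : ℂ := if w = 0 then 1 else Complex.sin w / w

/-- The Logan function `ℓ_c`, an entire function; the choice of the square root is irrelevant,
since `csinc` is even. -/
def logan (c : ℝ) (t : ℂ) : ℂ :=
  ((c / Real.sinh c : ℝ) : ℂ) * csinc ((t ^ 2 - (c : ℂ) ^ 2) ^ (1 / 2 : ℂ))

/-- The dilated Logan function `ℓ_{c,ε}(t) = ℓ_c(ε t)`. -/
def loganEps (c ε : ℝ) (t : ℂ) : ℂ := logan c ((ε : ℂ) * t)

/-- The inverse Fourier transform `η_c` of the Logan function. -/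
def eta (c y : ℝ) : ℝ :=
  chiStar (Set.Icc (-1) 1) y * (c / (2 * Real.sinh c)) * besselI0 (c * √(1 - y ^ 2))

/-- The dilated kernel `η_{c,ε}(y) = ε⁻¹ η_c(y / ε)`. -/
def etaEps (c ε y : ℝ) : ℝ := 1 / ε * eta c (y / ε)

/-- The number `λ_{c,ε} = ℓ_{c,ε}(i / 2)`, which is real (see `lam_eq`). -/
def lam (c ε : ℝ) : ℝ := (loganEps c ε (Complex.I / 2)).re

/-- The function `μ_{c,ε}`, odd by definition. -/
def muEps (c ε t : ℝ) : ℝ :=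
  if t < 0 then -∫ τ in Set.Iic t, etaEps c ε τ
  else if 0 < t then ∫ τ in Set.Iic (-t), etaEps c ε τ
  else 0

/-- The function `ν_{c,ε}`. -/
def nuEps (c ε t : ℝ) : ℝ := ∫ τ in Set.Iic t, muEps c ε τ

/-- `μ_c = μ_{c,1}`. -/
def mu (c t : ℝ) : ℝ := muEps c 1 t

/-- `ν_c = ν_{c,1}`. -/
def nu (c t : ℝ) : ℝ := nuEps c 1 t

/-- The weight `M_{x,c,ε}(t)`. -/
def weightM (x c ε t : ℝ) : ℝ :=
  (lam c ε)⁻¹ *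
    (muEps c ε (Real.log (t / x)) +
      (1 / Real.log t - 1 / 2) *
        (muEps c ε (Real.log (t / x)) * Real.log (t / x) - nuEps c ε (Real.log (t / x))))

/-- The pairs `(p, m)` with `p` prime, `m ≥ 1` and `p ^ m ∈ I`. -/
def primePowerPairs (I : Set ℝ) : Set (ℕ × ℕ) :=
  {q | q.1.Prime ∧ 1 ≤ q.2 ∧ (q.1 : ℝ) ^ q.2 ∈ I}

/-- The sum of `F(p ^ m) / m` over the prime powers `p ^ m ∈ I`, for a bounded set `I` (so that
the sum is finite, see `primePowerPairs_finite`). -/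
def primePowerSum (I : Set ℝ) (F : ℝ → ℝ) : ℝ :=
  ∑ᶠ q ∈ primePowerPairs I, 1 / (q.2 : ℝ) * F ((q.1 : ℝ) ^ q.2)

/-- The outer interval `I_α⁺`. -/
def outerPlus (x ε α : ℝ) : Set ℝ :=
  Set.Icc (Real.exp (α * ε) * x) (Real.exp ε * x)

/-- The outer interval `I_α⁻`. -/
def outerMinus (x ε α : ℝ) : Set ℝ :=
  Set.Icc (Real.exp (-ε) * x) (Real.exp (-(α * ε)) * x)

/-- The quantity `B`. -/
def sieveB (x c ε α : ℝ) : ℝ :=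
  ε * x * Real.exp (-ε) * |nu c α| / (2 * mu c α)

theorem primePowerPairs_finite {I : Set ℝ} (hI : BddAbove I) : (primePowerPairs I).Finite := by
  obtain ⟨b, hb⟩ := hI
  obtain ⟨N, hN⟩ := exists_nat_ge b
  refine ((Set.finite_Iic N).prod (Set.finite_Iic N)).subset ?_
  rintro ⟨p, m⟩ ⟨hp, hm, hpm⟩
  have h1 : p ^ m ≤ N := by
    have := (hb hpm).trans hN
    exact_mod_cast this
  exact ⟨(Nat.le_self_pow (by simp at hm; lia) p).trans h1, (Nat.lt_pow_self hp.one_lt).le.trans h1⟩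

theorem logan_half_I (c ε : ℝ) (hc : c ≠ 0) :
    loganEps c ε (Complex.I / 2) =
      ((c / Real.sinh c * (Real.sinh (√(c ^ 2 + ε ^ 2 / 4)) / √(c ^ 2 + ε ^ 2 / 4)) : ℝ) : ℂ) := by
  have hs : 0 < c ^ 2 + ε ^ 2 / 4 := by positivity
  set s := √(c ^ 2 + ε ^ 2 / 4) with hsdef
  have hs0 : 0 < s := Real.sqrt_pos.2 hs
  have hsq : s ^ 2 = c ^ 2 + ε ^ 2 / 4 := Real.sq_sqrt hs.le
  have hw : (((ε : ℂ) * (Complex.I / 2)) ^ 2 - (c : ℂ) ^ 2) = ((s : ℂ) * Complex.I) ^ 2 := by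
    have h2 : (s : ℂ) ^ 2 = (c : ℂ) ^ 2 + (ε : ℂ) ^ 2 / 4 := by exact_mod_cast hsq
    rw [mul_pow, mul_pow, div_pow, h2, Complex.I_sq]
    ring
  have hroot : (((s : ℂ) * Complex.I) ^ 2) ^ (1 / 2 : ℂ) = (s : ℂ) * Complex.I := by
    have harg : ((s : ℂ) * Complex.I).arg = Real.pi / 2 := by
      rw [Complex.arg_real_mul _ hs0, Complex.arg_I]
    have := Complex.pow_cpow_nat_inv (x := (s : ℂ) * Complex.I) (n := 2) two_ne_zero
      (by rw [harg]; norm_num; linarith [Real.pi_pos]) (by rw [harg]; norm_num)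
    simpa [one_div] using this
  have hsC : (s : ℂ) ≠ 0 := by exact_mod_cast hs0.ne'
  have hne : (s : ℂ) * Complex.I ≠ 0 := mul_ne_zero hsC Complex.I_ne_zero
  rw [loganEps, logan, hw, hroot, csinc, if_neg hne, Complex.sin_mul_I, mul_comm (s : ℂ),
    mul_comm (Complex.sinh _), mul_div_mul_left _ _ Complex.I_ne_zero]
  push_cast
  rfl

theorem lam_eq (c ε : ℝ) (hc : c ≠ 0) : ((lam c ε : ℝ) : ℂ) = loganEps c ε (Complex.I / 2) := by
  rw [lam, logan_half_I c ε hc, Complex.ofReal_re]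

end LoganSieve

end

/-! On either interval write t = x·e^{±εu} with α ≤ u ≤ 1. Since λ ≥ 1 and |ν_c(u)| ≤ (1-u)μ_c(u),
one gets |M(t)| ≤ e^ε μ_c(u) (`abs_weightM_le`), where μ_c is nonnegative and decreasing on the
positive reals and vanishes from 1 on. It remains to bound the sum of μ_c(u)/m over the prime
powers.

Primes: Selberg's sieve (`selberg_upper_bound`) is run on the integers coprime to 6 carrying these
monotone weights. Comparing sums with integrals in two residue classes modulo 6m shows that the
multiples of m have mass X/m with error at most 2μ_c(α), where X is a third of the integral of the
weight. The sieve then gives X/L + 2μ_c(α)(S/L)², with L = `selbergSum z` and S = `sigmaSum z` as in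
van Lint and Richert. At z = 6j one has L ≥ 6/5 + (log j)/3 (`le_selbergSum`) and S ≤ 4j
(`sigmaSum_le`). Taking j close to √(B/150), or z = 2 when B ≤ 150, yields a clean Brun–Titchmarsh
bound for every B > 1 (`exists_sieve_level`). The integral of the weight is at most εx·e^ε·|ν_c(α)|
(`integral_shellWeight_le`).

Higher powers: by Bernoulli's inequality each exponent m ≥ 2 admits at most 1 + 4ε√x/m bases. With
the weights 1/m and the trivial bound μ_c(u) ≤ μ_c(α), these sum to the second term
(`sum_higher_powers_le`). -/

noncomputable section

namespace LoganSieve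

/-! ### Selberg's sieve: weights, diagonalization and the upper bound. -/

section SelbergSieve

open Finset in
/-- Squarefree integers below `z` that are coprime to `6`: the support of the Selberg weights. -/
def sieveSupport (z : ℕ) : Finset ℕ := {n ∈ range z | Squarefree n ∧ n.Coprime 6}

/-- The Selberg sum `∑ 1 / φ(n)`. -/
def selbergSum (z : ℕ) : ℝ := ∑ n ∈ sieveSupport z, 1 / (n.totient : ℝ)

/-- The van Lint--Richert sum `∑ σ(n) / φ(n)`. -/
def sigmaSum (z : ℕ) : ℝ :=
  ∑ n ∈ sieveSupport z, (∑ d ∈ n.divisors, (d : ℝ)) / (n.totient : ℝ)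

open Finset in
/-- The Selberg weights. -/
def selbergWeight (z d : ℕ) : ℝ :=
  (ArithmeticFunction.moebius d : ℝ) * d *
    (∑ n ∈ sieveSupport z with d ∣ n, 1 / (n.totient : ℝ)) / selbergSum z

open Finset

theorem mem_sieveSupport {z n : ℕ} :
    n ∈ sieveSupport z ↔ n < z ∧ Squarefree n ∧ n.Coprime 6 := by
  simp [sieveSupport]

theorem sieveSupport_pos {z n : ℕ} (h : n ∈ sieveSupport z) : 0 < n :=
  Nat.pos_of_ne_zero (mem_sieveSupport.1 h).2.1.ne_zero

theorem mem_sieveSupport_of_dvd {z n d : ℕ} (h : n ∈ sieveSupport z) (hd : d ∣ n) :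
    d ∈ sieveSupport z := by
  have hn := sieveSupport_pos h
  rw [mem_sieveSupport] at h ⊢
  exact ⟨(Nat.le_of_dvd hn hd).trans_lt h.1, h.2.1.squarefree_of_dvd hd,
    h.2.2.coprime_dvd_left hd⟩

theorem one_mem_sieveSupport {z : ℕ} (hz : 1 < z) : 1 ∈ sieveSupport z := by
  simp [mem_sieveSupport, hz]

theorem selbergSum_pos {z : ℕ} (hz : 1 < z) : 0 < selbergSum z := by
  refine sum_pos (fun n hn => ?_) ⟨1, one_mem_sieveSupport hz⟩
  have := Nat.totient_pos.2 (sieveSupport_pos hn)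
  positivity

theorem selbergWeight_one {z : ℕ} (hz : 1 < z) : selbergWeight z 1 = 1 := by
  have := (selbergSum_pos hz).ne'
  simp only [selbergWeight, ArithmeticFunction.moebius_apply_one, Int.cast_one, Nat.cast_one,
    one_mul, one_dvd, filter_true]
  exact div_self this

/-- Exchanging the sums collects all d dividing a fixed n into σ(n). The square of this quantity
multiplies the remainder in the sieve. -/
theorem sum_abs_selbergWeight {z : ℕ} (hz : 1 < z) :
    ∑ d ∈ sieveSupport z, |selbergWeight z d| = sigmaSum z / selbergSum z := by
  have hL := selbergSum_pos hz
  have h1 : ∀ d ∈ sieveSupport z, |selbergWeight z d| =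
      (∑ n ∈ sieveSupport z, if d ∣ n then (d : ℝ) / (n.totient : ℝ) else 0) / selbergSum z := by
    intro d hd
    have hmu : |(ArithmeticFunction.moebius d : ℝ)| = 1 := by
      have := ArithmeticFunction.abs_moebius_eq_one_of_squarefree (mem_sieveSupport.1 hd).2.1
      exact_mod_cast this
    rw [selbergWeight, abs_div, abs_of_pos hL, abs_mul, abs_mul, hmu, one_mul, Nat.abs_cast,
      abs_of_nonneg (sum_nonneg fun n _ => by positivity), mul_sum, sum_filter]
    congr 1
    refine sum_congr rfl fun n _ => ?_
    split_ifs
    · ring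
    · rfl
  rw [sum_congr rfl h1, ← sum_div, sum_comm, sigmaSum]
  congr 1
  refine sum_congr rfl fun n hn => ?_
  rw [← sum_filter, sum_div]
  refine sum_congr ?_ fun _ _ => rfl
  ext d
  simp only [mem_filter, Nat.mem_divisors]
  exact ⟨fun h => ⟨h.2, (sieveSupport_pos hn).ne'⟩,
    fun h => ⟨mem_sieveSupport_of_dvd hn h.1, h.1⟩⟩

theorem sum_moebius_divisors (n : ℕ) :
    ∑ d ∈ n.divisors, ArithmeticFunction.moebius d = if n = 1 then 1 else 0 := by
  have := congrArg (fun f => f n) ArithmeticFunction.moebius_mul_coe_zeta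
  simpa only [ArithmeticFunction.coe_mul_zeta_apply, ArithmeticFunction.one_apply] using this

/-- With n = lk and l, k coprime, the terms are μ(l)μ(e) for e dividing k, so the Möbius sum over
the divisors of k decides. -/
theorem sum_moebius_between {l n : ℕ} (hn : Squarefree n) (hl : l ∣ n) :
    ∑ d ∈ n.divisors with l ∣ d, ArithmeticFunction.moebius d =
      if n = l then ArithmeticFunction.moebius l else 0 := by
  obtain ⟨k, rfl⟩ := hl
  have hne : l * k ≠ 0 := hn.ne_zero
  have hl0 : 0 < l := Nat.pos_of_ne_zero (left_ne_zero_of_mul hne)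
  have hcop : l.Coprime k := Nat.coprime_of_squarefree_mul hn
  have himg : {d ∈ (l * k).divisors | l ∣ d} = k.divisors.image (l * ·) := by
    ext d
    simp only [mem_filter, Nat.mem_divisors, mem_image]
    constructor
    · rintro ⟨⟨h1, h2⟩, ⟨e, rfl⟩⟩
      exact ⟨e, ⟨Nat.dvd_of_mul_dvd_mul_left hl0 h1, right_ne_zero_of_mul hne⟩, rfl⟩
    · rintro ⟨e, ⟨h1, h2⟩, rfl⟩
      exact ⟨⟨mul_dvd_mul_left l h1, hne⟩, dvd_mul_right l e⟩
  rw [himg, sum_image (fun a _ b _ h => Nat.eq_of_mul_eq_mul_left hl0 h)]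
  have : ∀ e ∈ k.divisors, ArithmeticFunction.moebius (l * e) =
      ArithmeticFunction.moebius l * ArithmeticFunction.moebius e := fun e he =>
    ArithmeticFunction.isMultiplicative_moebius.map_mul_of_coprime
      (hcop.coprime_dvd_right (Nat.dvd_of_mem_divisors he))
  rw [sum_congr rfl this, ← mul_sum, sum_moebius_divisors]
  have hiff : l * k = l ↔ k = 1 := by
    constructor
    · intro h
      exact Nat.eq_of_mul_eq_mul_left hl0 (by simpa using h)
    · rintro rfl
      simp
  by_cases hk : k = 1 <;> simp [hiff, hk]

/-- Möbius inversion of the definition of the weights. These sums are the coordinates in which the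
quadratic form of the sieve becomes diagonal. -/
theorem sum_selbergWeight_div {z l : ℕ} (hl : l ∈ sieveSupport z) :
    ∑ d ∈ sieveSupport z with l ∣ d, selbergWeight z d / d =
      (ArithmeticFunction.moebius l : ℝ) / (l.totient * selbergSum z) := by
  have h1 : ∀ d ∈ sieveSupport z, selbergWeight z d / d =
      (∑ n ∈ sieveSupport z, if d ∣ n then
        (ArithmeticFunction.moebius d : ℝ) * (1 / (n.totient : ℝ)) else 0) / selbergSum z := by
    intro d hd
    have hd0 : (d : ℝ) ≠ 0 := by exact_mod_cast (sieveSupport_pos hd).ne'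
    rw [selbergWeight, ← sum_filter, ← mul_sum]
    field_simp
  rw [sum_congr rfl fun d hd => h1 d (mem_filter.1 hd).1, ← sum_div, sum_comm]
  have h2 : ∀ n ∈ sieveSupport z, (∑ d ∈ sieveSupport z with l ∣ d, if d ∣ n then
        (ArithmeticFunction.moebius d : ℝ) * (1 / (n.totient : ℝ)) else 0) =
      if n = l then (ArithmeticFunction.moebius l : ℝ) * (1 / (l.totient : ℝ)) else 0 := by
    intro n hn
    rw [← sum_filter, filter_filter, ← sum_mul]
    by_cases hln : l ∣ n
    · have := sum_moebius_between (mem_sieveSupport.1 hn).2.1 hln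
      have hset : {d ∈ sieveSupport z | l ∣ d ∧ d ∣ n} = {d ∈ n.divisors | l ∣ d} := by
        ext d
        simp only [mem_filter, Nat.mem_divisors]
        exact ⟨fun h => ⟨⟨h.2.2, (sieveSupport_pos hn).ne'⟩, h.2.1⟩,
          fun h => ⟨mem_sieveSupport_of_dvd hn h.1.1, h.2, h.1.1⟩⟩
      rw [hset, ← Int.cast_sum, this]
      by_cases hnl : n = l
      · simp [hnl]
      · simp [hnl]
    · have hset : {d ∈ sieveSupport z | l ∣ d ∧ d ∣ n} = ∅ := by
        ext d
        simp only [mem_filter, notMem_empty, iff_false]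
        exact fun h => hln (h.2.1.trans h.2.2)
      have hnl : n ≠ l := fun h => hln (h ▸ dvd_rfl)
      simp [hset, hnl]
  rw [sum_congr rfl h2, sum_ite_eq' _ l, if_pos hl]
  rw [mul_one_div, div_div]

/-- Writing 1/lcm(a,b) = gcd(a,b)/(ab) and gcd(a,b) as the sum of φ(l) over common divisors l
diagonalizes the form. The l-th square contributes 1/(φ(l)L²). -/
theorem sum_selbergWeight_lcm {z : ℕ} (hz : 1 < z) :
    ∑ a ∈ sieveSupport z, ∑ b ∈ sieveSupport z,
      selbergWeight z a * selbergWeight z b / (a.lcm b : ℝ) = 1 / selbergSum z := by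
  have hL := selbergSum_pos hz
  have h1 : ∀ a ∈ sieveSupport z, ∀ b ∈ sieveSupport z,
      selbergWeight z a * selbergWeight z b / (a.lcm b : ℝ) =
        ∑ l ∈ sieveSupport z, (l.totient : ℝ) *
          ((if l ∣ a then selbergWeight z a / a else 0) *
            (if l ∣ b then selbergWeight z b / b else 0)) := by
    intro a ha b hb
    have ha0 : (a : ℝ) ≠ 0 := by exact_mod_cast (sieveSupport_pos ha).ne'
    have hb0 : (b : ℝ) ≠ 0 := by exact_mod_cast (sieveSupport_pos hb).ne'
    have hl0 : (a.lcm b : ℝ) ≠ 0 := by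
      exact_mod_cast Nat.lcm_ne_zero (sieveSupport_pos ha).ne' (sieveSupport_pos hb).ne'
    have hgl : (a.gcd b : ℝ) * (a.lcm b : ℝ) = a * b := by exact_mod_cast Nat.gcd_mul_lcm a b
    have hg : (a.gcd b : ℝ) = ∑ l ∈ sieveSupport z, if l ∣ a ∧ l ∣ b then (l.totient : ℝ) else 0 := by
      rw [← sum_filter]
      have hset : {l ∈ sieveSupport z | l ∣ a ∧ l ∣ b} = (a.gcd b).divisors := by
        ext d
        simp only [mem_filter, Nat.mem_divisors, Nat.dvd_gcd_iff]
        exact ⟨fun h => ⟨h.2, Nat.gcd_ne_zero_left (sieveSupport_pos ha).ne'⟩,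
          fun h => ⟨mem_sieveSupport_of_dvd ha h.1.1, h.1⟩⟩
      rw [hset]
      exact_mod_cast (Nat.sum_totient (a.gcd b)).symm
    have h2 : selbergWeight z a * selbergWeight z b / (a.lcm b : ℝ) =
        (a.gcd b : ℝ) * (selbergWeight z a / a * (selbergWeight z b / b)) := by
      field_simp
      linear_combination -(selbergWeight z a * selbergWeight z b) * hgl
    rw [h2, hg, sum_mul]
    refine sum_congr rfl fun l _ => ?_
    by_cases h3 : l ∣ a <;> by_cases h4 : l ∣ b <;> simp [h3, h4]
  rw [sum_congr rfl fun a ha => sum_congr rfl (h1 a ha)]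
  have h3 : ∑ a ∈ sieveSupport z, ∑ b ∈ sieveSupport z, ∑ l ∈ sieveSupport z, (l.totient : ℝ) *
          ((if l ∣ a then selbergWeight z a / a else 0) *
            (if l ∣ b then selbergWeight z b / b else 0)) =
      ∑ l ∈ sieveSupport z, (l.totient : ℝ) *
        (∑ d ∈ sieveSupport z with l ∣ d, selbergWeight z d / d) ^ 2 := by
    rw [sum_congr rfl fun a _ => sum_comm, sum_comm]
    refine sum_congr rfl fun l _ => ?_
    rw [sum_filter, sq, sum_mul_sum, mul_sum]
    simp_rw [mul_sum]
  rw [h3, sum_congr rfl fun l hl => by rw [sum_selbergWeight_div hl]]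
  have h4 : ∀ l ∈ sieveSupport z, (l.totient : ℝ) *
      ((ArithmeticFunction.moebius l : ℝ) / (l.totient * selbergSum z)) ^ 2 =
        1 / (l.totient : ℝ) / selbergSum z ^ 2 := by
    intro l hl
    have hmu : (ArithmeticFunction.moebius l : ℝ) ^ 2 = 1 := by
      have := ArithmeticFunction.moebius_sq_eq_one_of_squarefree (mem_sieveSupport.1 hl).2.1
      exact_mod_cast this
    have hp : (l.totient : ℝ) ≠ 0 := by
      exact_mod_cast (Nat.totient_pos.2 (sieveSupport_pos hl)).ne'
    rw [div_pow, hmu]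
    field_simp
  rw [sum_congr rfl h4, ← sum_div]
  change selbergSum z / selbergSum z ^ 2 = _
  field_simp

/-- Selberg's upper bound sieve for a weighted finite set of integers that is equidistributed in
the multiples of every integer coprime to `6`. -/
theorem selberg_upper_bound {z : ℕ} (hz : 1 < z) (A : Finset ℕ) (w : ℕ → ℝ) {X R : ℝ}
    (hw : ∀ n ∈ A, 0 ≤ w n)
    (hR : ∀ m : ℕ, 0 < m → m.Coprime 6 → |∑ n ∈ A with m ∣ n, w n - X / m| ≤ R) :
    ∑ n ∈ A with n.Prime ∧ z ≤ n, w n ≤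
      X / selbergSum z + R * (sigmaSum z / selbergSum z) ^ 2 := by
  set lam' := selbergWeight z with hlam
  have h1 : ∑ n ∈ A with n.Prime ∧ z ≤ n, w n ≤
      ∑ n ∈ A, w n * (∑ d ∈ sieveSupport z with d ∣ n, lam' d) ^ 2 := by
    calc ∑ n ∈ A with n.Prime ∧ z ≤ n, w n
        = ∑ n ∈ A with n.Prime ∧ z ≤ n,
            w n * (∑ d ∈ sieveSupport z with d ∣ n, lam' d) ^ 2 := by
          refine sum_congr rfl fun n hn => ?_
          obtain ⟨-, hp, hzn⟩ := mem_filter.1 hn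
          -- A prime n ≥ z has no divisor below z except 1, so the square equals 1 at the primes to
          -- be counted.
          have hset : {d ∈ sieveSupport z | d ∣ n} = {1} := by
            ext d
            simp only [mem_filter, mem_singleton]
            constructor
            · rintro ⟨hd, hdn⟩
              rcases (Nat.dvd_prime hp).1 hdn with h | h
              · exact h
              · have := (mem_sieveSupport.1 hd).1
                omega
            · rintro rfl
              exact ⟨one_mem_sieveSupport hz, one_dvd n⟩
          rw [hset, sum_singleton, hlam, selbergWeight_one hz]
          ring
      _ ≤ _ := sum_le_sum_of_subset_of_nonneg (filter_subset _ _)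
          fun n hn _ => mul_nonneg (hw n hn) (sq_nonneg _)
  have h2 : ∑ n ∈ A, w n * (∑ d ∈ sieveSupport z with d ∣ n, lam' d) ^ 2 =
      ∑ a ∈ sieveSupport z, ∑ b ∈ sieveSupport z,
        lam' a * lam' b * ∑ n ∈ A with a.lcm b ∣ n, w n := by
    have h3 : ∀ n ∈ A, w n * (∑ d ∈ sieveSupport z with d ∣ n, lam' d) ^ 2 =
        ∑ a ∈ sieveSupport z, ∑ b ∈ sieveSupport z,
          lam' a * lam' b * if a.lcm b ∣ n then w n else 0 := by
      intro n _
      rw [sum_filter, sq, sum_mul_sum, mul_sum]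
      refine sum_congr rfl fun a _ => ?_
      rw [mul_sum]
      refine sum_congr rfl fun b _ => ?_
      by_cases h3 : a ∣ n <;> by_cases h4 : b ∣ n <;> simp [Nat.lcm_dvd_iff, h3, h4]
      ring
    rw [sum_congr rfl h3, sum_comm]
    refine sum_congr rfl fun a _ => ?_
    rw [sum_comm]
    refine sum_congr rfl fun b _ => ?_
    rw [← mul_sum, sum_filter]
  have h4 : ∀ a ∈ sieveSupport z, ∀ b ∈ sieveSupport z,
      lam' a * lam' b * ∑ n ∈ A with a.lcm b ∣ n, w n ≤
        X * (lam' a * lam' b / (a.lcm b : ℝ)) + R * (|lam' a| * |lam' b|) := by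
    intro a ha b hb
    have hcop : (a.lcm b).Coprime 6 := by
      have := (mem_sieveSupport.1 ha).2.2.mul_left (mem_sieveSupport.1 hb).2.2
      exact this.coprime_dvd_left (Nat.lcm_dvd_mul a b)
    have h5 := hR (a.lcm b) (Nat.lcm_pos (sieveSupport_pos ha) (sieveSupport_pos hb)) hcop
    have h6 : lam' a * lam' b * (∑ n ∈ A with a.lcm b ∣ n, w n - X / (a.lcm b : ℝ)) ≤
        |lam' a| * |lam' b| * R := by
      refine (le_abs_self _).trans ?_
      rw [abs_mul, abs_mul]
      gcongr
    have h7 : X * (lam' a * lam' b / (a.lcm b : ℝ)) = lam' a * lam' b * (X / (a.lcm b : ℝ)) := by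
      ring
    linarith
  refine h1.trans (h2.le.trans ((sum_le_sum fun a ha => sum_le_sum (h4 a ha)).trans ?_))
  simp_rw [sum_add_distrib, ← mul_sum, ← sum_mul]
  rw [hlam, sum_selbergWeight_lcm hz, sum_abs_selbergWeight hz]
  exact le_of_eq (by ring)

end SelbergSieve

/-! ### Explicit bounds for the Selberg sum and the van Lint–Richert sum. -/

section SelbergSums

open Finset

theorem totient_eq_mul_prod (n : ℕ) :
    (n.totient : ℝ) = n * ∏ p ∈ n.primeFactors, (1 - (p : ℝ)⁻¹) := by
  have h := congrArg (fun q : ℚ => (q : ℝ)) (Nat.totient_eq_mul_prod_factors n)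
  push_cast at h
  exact h

/-- Every m with radical n is n times an integer composed of primes of n. The reciprocals of those
integers sum to the Euler product n/φ(n). -/
theorem sum_inv_radical_eq_le (z n : ℕ) (hn : Squarefree n) :
    ∑ m ∈ range z with m.Coprime 6 ∧ ∏ p ∈ m.primeFactors, p = n, 1 / (m : ℝ) ≤
      1 / (n.totient : ℝ) := by
  let f : ℕ →* ℝ := (invMonoidWithZeroHom.comp (Nat.castRingHom ℝ).toMonoidWithZeroHom : ℕ →*₀ ℝ)
  have hf : ∀ m, f m = (m : ℝ)⁻¹ := fun m => rfl
  have hn0 : n ≠ 0 := hn.ne_zero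
  have hnR : (0 : ℝ) < n := by exact_mod_cast Nat.pos_of_ne_zero hn0
  obtain ⟨hsum, hhas⟩ :=
    EulerProduct.summable_and_hasSum_factoredNumbers_prod_filter_prime_geometric (f := f)
      (fun {p} hp => by
        rw [hf, norm_inv, Real.norm_natCast]
        exact inv_lt_one_of_one_lt₀ (by exact_mod_cast hp.one_lt)) n.primeFactors
  have hprod : ∏ p ∈ n.primeFactors with p.Prime, (1 - f p)⁻¹ = n / n.totient := by
    have h1 : n.primeFactors.filter Nat.Prime = n.primeFactors :=
      filter_true_of_mem fun p hp => Nat.prime_of_mem_primeFactors hp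
    rw [h1, totient_eq_mul_prod, prod_inv_distrib]
    simp only [hf]
    rw [div_mul_eq_div_div, div_self hnR.ne', one_div]
  rw [hprod] at hhas
  set s := {m ∈ range z | m.Coprime 6 ∧ ∏ p ∈ m.primeFactors, p = n} with hs
  have hdiv : ∀ m ∈ s, m ≠ 0 ∧ n ∣ m ∧ m / n ∈ Nat.factoredNumbers n.primeFactors := by
    intro m hm
    obtain ⟨-, hcop, hrad⟩ := mem_filter.1 hm
    have hm0 : m ≠ 0 := by
      rintro rfl
      simp at hcop
    have hdvd : n ∣ m := hrad ▸ Nat.prod_primeFactors_dvd m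
    refine ⟨hm0, hdvd, Nat.mem_factoredNumbers_iff_primeFactors_subset.2 ⟨?_, ?_⟩⟩
    · exact (Nat.div_pos (Nat.le_of_dvd (Nat.pos_of_ne_zero hm0) hdvd)
        (Nat.pos_of_ne_zero hn0)).ne'
    · rw [← hrad, Nat.primeFactors_prod_primeFactors, hrad]
      exact Nat.primeFactors_mono (Nat.div_dvd_of_dvd hdvd) hm0
  have h1 : ∑ m ∈ s, 1 / (m : ℝ) = (n : ℝ)⁻¹ * ∑ m ∈ s, f (m / n) := by
    rw [mul_sum]
    refine sum_congr rfl fun m hm => ?_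
    obtain ⟨hm0, hdvd, -⟩ := hdiv m hm
    rw [hf, Nat.cast_div hdvd hnR.ne', inv_div, one_div]
    field_simp
  have h2 : ∑ m ∈ s, f (m / n) ≤ n / n.totient := by
    let e : s → Nat.factoredNumbers n.primeFactors := fun m => ⟨m.1 / n, (hdiv m.1 m.2).2.2⟩
    have he : Function.Injective e := by
      intro a b hab
      have h3 : a.1 / n = b.1 / n := congrArg Subtype.val hab
      have h4 := Nat.div_mul_cancel (hdiv a.1 a.2).2.1
      have h5 := Nat.div_mul_cancel (hdiv b.1 b.2).2.1
      exact Subtype.ext (by rw [← h4, ← h5, h3])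
    rw [← sum_coe_sort s fun m => f (m / n)]
    have h6 : ∑ m : s, f (m.1 / n) = ∑ m ∈ univ.map ⟨e, he⟩, f m.1 := by
      rw [sum_map]
      rfl
    rw [h6]
    exact sum_le_hasSum _ (fun m _ => by rw [hf]; positivity) hhas
  rw [h1]
  calc (n : ℝ)⁻¹ * ∑ m ∈ s, f (m / n) ≤ (n : ℝ)⁻¹ * (n / n.totient) := by gcongr
    _ = 1 / n.totient := by field_simp

theorem sum_inv_le_selbergSum (z : ℕ) :
    ∑ m ∈ range z with m.Coprime 6, 1 / (m : ℝ) ≤ selbergSum z := by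
  have hmaps : ∀ m ∈ {m ∈ range z | m.Coprime 6}, ∏ p ∈ m.primeFactors, p ∈ sieveSupport z := by
    intro m hm
    obtain ⟨hmz, hcop⟩ := mem_filter.1 hm
    have hm0 : m ≠ 0 := by
      rintro rfl
      simp at hcop
    have hdvd := Nat.prod_primeFactors_dvd m
    refine mem_sieveSupport.2 ⟨(Nat.le_of_dvd (Nat.pos_of_ne_zero hm0) hdvd).trans_lt
      (mem_range.1 hmz), ?_, hcop.coprime_dvd_left hdvd⟩
    have := UniqueFactorizationMonoid.squarefree_radical (a := m)
    rwa [Nat.radical_eq_prod_primeFactors] at this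
  rw [← sum_fiberwise_of_maps_to hmaps]
  refine sum_le_sum fun n hn => ?_
  rw [filter_filter]
  exact sum_inv_radical_eq_le z n (mem_sieveSupport.1 hn).2.1

/-- The right side is a Padé approximant agreeing with the logarithm through t³. Such precision is
needed in `le_sum_inv_coprime_six`, whose two sides grow alike up to third order in 1/j. -/
theorem log_one_add_le_pade {t : ℝ} (ht : 0 ≤ t) :
    Real.log (1 + t) ≤ t * (6 + t) / (6 + 4 * t) := by
  let F : ℝ → ℝ := fun t => t * (6 + t) / (6 + 4 * t) - Real.log (1 + t)
  have hder : ∀ t : ℝ, 0 ≤ t → HasDerivAt F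
      (((1 * (6 + t) + t * 1) * (6 + 4 * t) - t * (6 + t) * (4 * 1)) / (6 + 4 * t) ^ 2
        - 1 / (1 + t)) t := by
    intro t ht
    have h1 : HasDerivAt (fun t : ℝ => t * (6 + t)) (1 * (6 + t) + t * 1) t :=
      (hasDerivAt_id t).mul ((hasDerivAt_id t).const_add 6)
    have h2 : HasDerivAt (fun t : ℝ => 6 + 4 * t) (4 * 1) t :=
      ((hasDerivAt_id t).const_mul 4).const_add 6
    have h3 : HasDerivAt (fun t : ℝ => Real.log (1 + t)) (1 / (1 + t)) t :=
      ((hasDerivAt_id t).const_add 1).log (by simp only [id]; positivity)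
    exact (h1.div h2 (by positivity)).sub h3
  have hmono : MonotoneOn F (Set.Ici 0) := by
    refine monotoneOn_of_deriv_nonneg (convex_Ici 0)
      (fun t ht => (hder t ht).continuousAt.continuousWithinAt)
      (fun t ht => (hder t (interior_subset ht)).differentiableAt.differentiableWithinAt) ?_
    intro t ht
    have ht0 : 0 ≤ t := interior_subset ht
    rw [(hder t ht0).deriv, sub_nonneg, div_le_div_iff₀ (by positivity) (by positivity)]
    nlinarith [pow_nonneg ht0 3]
  have := hmono (Set.mem_Ici.2 le_rfl) (Set.mem_Ici.2 ht) ht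
  simp only [F] at this
  norm_num at this
  exact this

/-- A further block of six integers adds 1/(6j+1) + 1/(6j+5), which is at least (1/3)·log(1 + 1/j).
The constant is the value 1 + 1/5 at j = 1. -/
theorem le_sum_inv_coprime_six {j : ℕ} (hj : 1 ≤ j) :
    6 / 5 + Real.log j / 3 ≤ ∑ m ∈ range (6 * j) with m.Coprime 6, 1 / (m : ℝ) := by
  simp_rw [sum_filter]
  induction j, hj using Nat.le_induction with
  | base =>
    have : ∀ m ∈ range (6 * 1), (if m.Coprime 6 then 1 / (m : ℝ) else 0) =
        if m = 1 then 1 else if m = 5 then 1 / 5 else 0 := by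
      intro m hm
      have : m < 6 := by simpa using hm
      interval_cases m <;> norm_num
    rw [sum_congr rfl this]
    norm_num [sum_range_succ]
  | succ j hj ih =>
    have hj0 : (0 : ℝ) < j := by exact_mod_cast hj
    rw [mul_add, mul_one, sum_range_add]
    simp only [sum_range_succ, sum_range_zero, zero_add, add_zero]
    have h1 : (6 * j + 1).Coprime 6 := by simp
    have h5 : (6 * j + 5).Coprime 6 := by
      rw [Nat.coprime_mul_left_add_left]
      norm_num
    have hnn : ∀ m : ℕ, 0 ≤ if m.Coprime 6 then 1 / (m : ℝ) else 0 := by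
      intro m
      split_ifs <;> positivity
    have e1 : (if (6 * j + 1).Coprime 6 then 1 / ((6 * j + 1 : ℕ) : ℝ) else 0) =
        1 / (6 * j + 1) := by rw [if_pos h1]; push_cast; rfl
    have e5 : (if (6 * j + 5).Coprime 6 then 1 / ((6 * j + 5 : ℕ) : ℝ) else 0) =
        1 / (6 * j + 5) := by rw [if_pos h5]; push_cast; rfl
    have hlog : Real.log ((j + 1 : ℕ) : ℝ) ≤ Real.log j +
        3 * (1 / (6 * j + 1) + 1 / (6 * j + 5)) := by
      have h6 : ((j + 1 : ℕ) : ℝ) = j * (1 + 1 / j) := by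
        push_cast
        field_simp
      rw [h6, Real.log_mul hj0.ne' (by positivity)]
      have h7 := log_one_add_le_pade (t := 1 / (j : ℝ)) (by positivity)
      have h8 : 1 / (j : ℝ) * (6 + 1 / j) / (6 + 4 * (1 / j)) ≤
          3 * (1 / (6 * j + 1) + 1 / (6 * j + 5)) := by
        have h9 : 1 / (j : ℝ) * (6 + 1 / j) / (6 + 4 * (1 / j)) =
            (6 * j + 1) / (j * (6 * j + 4)) := by field_simp
        have h10 : (3 : ℝ) * (1 / (6 * j + 1) + 1 / (6 * j + 5)) =
            (36 * j + 18) / ((6 * j + 1) * (6 * j + 5)) := by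
          field_simp
          ring
        rw [h9, h10, div_le_div_iff₀ (by positivity) (by positivity)]
        have : (1 : ℝ) ≤ j := by exact_mod_cast hj
        nlinarith
      linarith
    have h2 := hnn (6 * j)
    have h3 := hnn (6 * j + 2)
    have h4 := hnn (6 * j + 3)
    have h6 := hnn (6 * j + 4)
    have e1' := e1.symm.le
    have e5' := e5.symm.le
    push_cast at *
    linarith

theorem le_selbergSum {j : ℕ} (hj : 1 ≤ j) : 6 / 5 + Real.log j / 3 ≤ selbergSum (6 * j) :=
  (le_sum_inv_coprime_six hj).trans (sum_inv_le_selbergSum _)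

/-- Primes that may divide an element of `sieveSupport z`. -/
def sievePrimes (z : ℕ) : Finset ℕ := {p ∈ range z | p.Prime ∧ 5 ≤ p}

theorem mem_sievePrimes {z p : ℕ} : p ∈ sievePrimes z ↔ p < z ∧ p.Prime ∧ 5 ≤ p := by
  simp [sievePrimes]

theorem primeFactors_subset_sievePrimes {z n : ℕ} (hn : n ∈ sieveSupport z) :
    n.primeFactors ⊆ sievePrimes z := by
  intro p hp
  have hpp := Nat.prime_of_mem_primeFactors hp
  have hd := Nat.dvd_of_mem_primeFactors hp
  have h1 := mem_sieveSupport.1 (mem_sieveSupport_of_dvd hn hd)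
  refine mem_sievePrimes.2 ⟨h1.1, hpp, ?_⟩
  by_contra! h
  have := hpp.two_le
  have h2 := h1.2.2
  interval_cases p <;> revert hpp h2 <;> norm_num

/-- The primes are replaced by all odd n ≥ 5. Each factor is at most n(n-1)/((n-2)(n+1)), and the
product of these over consecutive odd n telescopes. -/
theorem prod_sievePrimes_le (k : ℕ) :
    ∏ p ∈ sievePrimes (2 * k + 5), (1 + 2 / (((p : ℝ) - 1) * p)) ≤
      4 / 3 * ((2 * k + 3) / (2 * k + 4)) := by
  induction k with
  | zero =>
    have : sievePrimes (2 * 0 + 5) = ∅ := by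
      ext p
      simp only [mem_sievePrimes, notMem_empty, iff_false]
      omega
    rw [this]
    norm_num
  | succ k ih =>
    have hsub : sievePrimes (2 * (k + 1) + 5) ⊆ insert (2 * k + 5) (sievePrimes (2 * k + 5)) := by
      intro p hp
      obtain ⟨h1, h2, h3⟩ := mem_sievePrimes.1 hp
      rw [mem_insert, mem_sievePrimes]
      have h4 : p ≠ 2 * k + 6 := by
        rintro rfl
        exact Nat.not_prime_mul (by norm_num : (2 : ℕ) ≠ 1) (by omega : k + 3 ≠ 1)
          (by rwa [mul_add])
      by_cases h5 : p = 2 * k + 5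
      · exact Or.inl h5
      · exact Or.inr ⟨by omega, h2, h3⟩
    have hge : ∀ p ∈ insert (2 * k + 5) (sievePrimes (2 * k + 5)),
        (1 : ℝ) ≤ 1 + 2 / (((p : ℝ) - 1) * p) := by
      intro p hp
      have h1 : 5 ≤ p := by
        rcases mem_insert.1 hp with h | h
        · omega
        · exact (mem_sievePrimes.1 h).2.2
      have h2 : (5 : ℝ) ≤ p := by exact_mod_cast h1
      have h3 : 0 < ((p : ℝ) - 1) * p := mul_pos (by linarith) (by linarith)
      have := div_pos two_pos h3
      linarith
    refine (prod_le_prod_of_subset_of_one_le hsub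
      (fun p hp => zero_le_one.trans (hge p (hsub hp))) fun p hp _ => hge p hp).trans ?_
    rw [prod_insert (by simp [mem_sievePrimes])]
    have h0 : (0 : ℝ) ≤ k := by positivity
    have h1 : (0 : ℝ) ≤ 1 + 2 / ((((2 * k + 5 : ℕ) : ℝ) - 1) * ((2 * k + 5 : ℕ) : ℝ)) :=
      zero_le_one.trans (hge _ (mem_insert_self _ _))
    refine (mul_le_mul_of_nonneg_left ih h1).trans ?_
    push_cast
    have h2 : (1 : ℝ) + 2 / ((2 * k + 5 - 1) * (2 * k + 5)) ≤
        (2 * k + 4) * (2 * k + 5) / ((2 * k + 3) * (2 * k + 6)) := by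
      have h3 : (2 * (k : ℝ) + 5 - 1) = 2 * k + 4 := by ring
      rw [h3, ← sub_nonneg]
      have h4 : (2 * (k : ℝ) + 4) * (2 * k + 5) / ((2 * k + 3) * (2 * k + 6)) -
          (1 + 2 / ((2 * k + 4) * (2 * k + 5))) =
          4 / ((2 * k + 3) * (2 * k + 6) * ((2 * k + 4) * (2 * k + 5))) := by
        field_simp
        ring
      rw [h4]
      positivity
    calc _ ≤ (2 * (k : ℝ) + 4) * (2 * k + 5) / ((2 * k + 3) * (2 * k + 6)) *
          (4 / 3 * ((2 * k + 3) / (2 * k + 4))) := by gcongr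
      _ = 4 / 3 * ((2 * (k + 1) + 3) / (2 * (k + 1) + 4)) := by
        field_simp
        ring

theorem prod_sievePrimes_le_four_thirds (z : ℕ) :
    ∏ p ∈ sievePrimes z, (1 + 2 / (((p : ℝ) - 1) * p)) ≤ 4 / 3 := by
  have hge : ∀ y : ℕ, ∀ p ∈ sievePrimes y, (1 : ℝ) ≤ 1 + 2 / (((p : ℝ) - 1) * p) := by
    intro y p hp
    have h2 : (5 : ℝ) ≤ p := by exact_mod_cast (mem_sievePrimes.1 hp).2.2
    have h3 : 0 < ((p : ℝ) - 1) * p := mul_pos (by linarith) (by linarith)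
    have := div_pos two_pos h3
    linarith
  have hsub : sievePrimes z ⊆ sievePrimes (2 * z + 5) := fun p hp => by
    rw [mem_sievePrimes] at hp ⊢
    exact ⟨by omega, hp.2⟩
  refine (prod_le_prod_of_subset_of_one_le hsub
    (fun p hp => zero_le_one.trans (hge _ p hp)) fun p hp _ => hge _ p hp).trans
    ((prod_sievePrimes_le z).trans ?_)
  have : (2 * (z : ℝ) + 3) / (2 * z + 4) ≤ 1 := by
    rw [div_le_one (by positivity)]
    linarith
  linarith

/-- Each prime contributes (p+1)/(p-1) = 1 + 2/(p-1); the product is then expanded. -/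
theorem sigma_div_totient_eq {n : ℕ} (hn : Squarefree n) :
    (∑ d ∈ n.divisors, (d : ℝ)) / (n.totient : ℝ) =
      ∑ t ∈ n.primeFactors.powerset, ∏ p ∈ t, (2 / ((p : ℝ) - 1)) := by
  have h1 : ∑ d ∈ n.divisors, (d : ℝ) = ∏ p ∈ n.primeFactors, (1 + (p : ℝ)) := by
    have := ArithmeticFunction.IsMultiplicative.prodPrimeFactors_one_add_of_squarefree
      (ArithmeticFunction.isMultiplicative_id.natCast (R := ℝ)) hn
    simpa using this.symm
  have h2 : (n.totient : ℝ) = ∏ p ∈ n.primeFactors, ((p : ℝ) - 1) := by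
    have h4 : (n : ℝ) = ∏ p ∈ n.primeFactors, (p : ℝ) := by
      rw [← Nat.cast_prod, Nat.prod_primeFactors_of_squarefree hn]
    rw [totient_eq_mul_prod]
    nth_rewrite 1 [h4]
    rw [← prod_mul_distrib]
    refine prod_congr rfl fun p hp => ?_
    have : (p : ℝ) ≠ 0 := by exact_mod_cast (Nat.prime_of_mem_primeFactors hp).ne_zero
    field_simp
  rw [h1, h2, ← prod_div_distrib, ← prod_one_add]
  refine prod_congr rfl fun p hp => ?_
  have : (2 : ℝ) ≤ p := by exact_mod_cast (Nat.prime_of_mem_primeFactors hp).two_le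
  have : (p : ℝ) - 1 ≠ 0 := by linarith
  field_simp
  ring

theorem card_coprime_six_le (j : ℕ) : #{n ∈ range (6 * j) | n.Coprime 6} = 2 * j := by
  rw [card_filter]
  induction j with
  | zero => simp
  | succ j ih =>
    have h : ∀ r, (6 * j + r).Coprime 6 ↔ r.Coprime 6 := fun r => by
      rw [Nat.coprime_mul_left_add_left]
    rw [mul_add, mul_one, sum_range_add, ih]
    simp only [h]
    norm_num [sum_range_succ]
    rfl

theorem card_multiples_le {d z : ℕ} (hd : 0 < d) (s : Finset ℕ)
    (hs : ∀ n ∈ s, 0 < n ∧ n ≤ z ∧ d ∣ n) : (#s : ℝ) ≤ z / d := by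
  have h1 : #s ≤ #(Ioc 0 (z / d)) := by
    refine card_le_card_of_injOn (· / d) (fun n hn => ?_) fun a ha b hb hab => ?_
    · obtain ⟨h1, h2, h3⟩ := hs n hn
      simp only [coe_Ioc, Set.mem_Ioc]
      exact ⟨Nat.div_pos (Nat.le_of_dvd h1 h3) hd, Nat.div_le_div_right h2⟩
    · have h4 := Nat.div_mul_cancel (hs a ha).2.2
      have h5 := Nat.div_mul_cancel (hs b hb).2.2
      simp only at hab
      rw [← h4, ← h5, hab]
  rw [Nat.card_Ioc, Nat.sub_zero] at h1
  exact (Nat.cast_le.2 h1).trans Nat.cast_div_le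

/-- After expanding σ/φ, the empty set of primes contributes at most the 2j integers coprime to 6.
For a nonempty set t it suffices to count all multiples of the product of t below 6j. The total is
at most 2j + (6j-1)(4/3 - 1). -/
theorem sigmaSum_le (j : ℕ) (hj : 1 ≤ j) : sigmaSum (6 * j) ≤ 4 * j := by
  set z := 6 * j with hz
  set g : Finset ℕ → ℝ := fun t => ∏ p ∈ t, (2 / ((p : ℝ) - 1)) with hg
  have hg0 : ∀ t ⊆ sievePrimes z, 0 ≤ g t := fun t ht => prod_nonneg fun p hp => by
    have h2 : (5 : ℝ) ≤ p := by exact_mod_cast (mem_sievePrimes.1 (ht hp)).2.2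
    exact div_nonneg zero_le_two (by linarith)
  have h1 : sigmaSum z = ∑ t ∈ (sievePrimes z).powerset,
      g t * #{n ∈ sieveSupport z | t ⊆ n.primeFactors} := by
    have h2 : ∀ n ∈ sieveSupport z, (∑ d ∈ n.divisors, (d : ℝ)) / (n.totient : ℝ) =
        ∑ t ∈ (sievePrimes z).powerset, if t ⊆ n.primeFactors then g t else 0 := by
      intro n hn
      rw [sigma_div_totient_eq (mem_sieveSupport.1 hn).2.1, ← sum_filter]
      refine sum_congr ?_ fun _ _ => rfl
      ext t
      simp only [mem_filter, mem_powerset]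
      exact ⟨fun h => ⟨h.trans (primeFactors_subset_sievePrimes hn), h⟩, fun h => h.2⟩
    rw [sigmaSum, sum_congr rfl h2, sum_comm]
    refine sum_congr rfl fun t _ => ?_
    rw [← sum_filter, sum_const, nsmul_eq_mul, mul_comm]
  have hz1 : ((z - 1 : ℕ) : ℝ) = 6 * j - 1 := by
    rw [Nat.cast_sub (by omega), hz]
    push_cast
    ring
  have h3 : ∀ t ⊆ sievePrimes z, t ≠ ∅ →
      g t * #{n ∈ sieveSupport z | t ⊆ n.primeFactors} ≤
        (6 * j - 1) * ∏ p ∈ t, (2 / (((p : ℝ) - 1) * p)) := by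
    intro t ht _
    have hpos : 0 < ∏ p ∈ t, p := prod_pos fun p hp => (mem_sievePrimes.1 (ht hp)).2.1.pos
    have h4 := card_multiples_le (z := z - 1) hpos {n ∈ sieveSupport z | t ⊆ n.primeFactors}
      (fun n hn => by
        obtain ⟨h5, h6⟩ := mem_filter.1 hn
        have h7 := (mem_sieveSupport.1 h5).1
        exact ⟨sieveSupport_pos h5, by omega,
          (prod_dvd_prod_of_subset _ _ _ h6).trans (Nat.prod_primeFactors_dvd n)⟩)
    refine (mul_le_mul_of_nonneg_left h4 (hg0 t ht)).trans (le_of_eq ?_)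
    rw [hz1]
    push_cast
    simp only [hg, div_mul_eq_div_div]
    rw [prod_div_distrib (g := fun p : ℕ => (p : ℝ))]
    ring
  have h5 : ∑ t ∈ (sievePrimes z).powerset, ∏ p ∈ t, (2 / (((p : ℝ) - 1) * p)) ≤ 4 / 3 := by
    rw [← prod_one_add]
    exact prod_sievePrimes_le_four_thirds z
  have hmem : ∅ ∈ (sievePrimes z).powerset := empty_mem_powerset _
  rw [← add_sum_erase _ _ hmem, prod_empty] at h5
  rw [h1, ← add_sum_erase _ _ hmem]
  have h6 : g ∅ * (#{n ∈ sieveSupport z | ∅ ⊆ n.primeFactors} : ℝ) ≤ 2 * j := by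
    simp only [hg, prod_empty, one_mul, empty_subset, filter_true]
    rw [← Nat.cast_ofNat, ← Nat.cast_mul, ← card_coprime_six_le j]
    refine Nat.cast_le.2 (card_le_card fun n hn => ?_)
    have := mem_sieveSupport.1 hn
    exact mem_filter.2 ⟨mem_range.2 this.1, this.2.2⟩
  have h7 : ∑ t ∈ (sievePrimes z).powerset.erase ∅,
      g t * #{n ∈ sieveSupport z | t ⊆ n.primeFactors} ≤
        (6 * j - 1) * ∑ t ∈ (sievePrimes z).powerset.erase ∅,
          ∏ p ∈ t, (2 / (((p : ℝ) - 1) * p)) := by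
    rw [mul_sum]
    exact sum_le_sum fun t ht =>
      h3 t (mem_powerset.1 (mem_of_mem_erase ht)) (ne_of_mem_erase ht)
  have hj1 : (1 : ℝ) ≤ j := by exact_mod_cast hj
  nlinarith

end SelbergSums

/-! ### Choice of the sieve level. -/

section Level

open Finset

theorem sieveSupport_two : sieveSupport 2 = {1} := by
  ext n
  rw [mem_sieveSupport, mem_singleton]
  constructor
  · rintro ⟨h1, h2, -⟩
    have := h2.ne_zero
    omega
  · rintro rfl
    norm_num

theorem selbergSum_two : selbergSum 2 = 1 := by
  simp [selbergSum, sieveSupport_two]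

theorem sigmaSum_two : sigmaSum 2 = 1 := by
  simp [sigmaSum, sieveSupport_two]

/-- This is 2b/3 + 2 ≤ 4b/log b rearranged: the bound wanted at level z = 2, where L = S = 1. -/
theorem log_le_of_le_150 {b : ℝ} (hb : 1 < b) (hb' : b ≤ 150) :
    Real.log b ≤ 6 * b / (b + 3) := by
  have hb0 : 0 < b := by linarith
  rw [le_div_iff₀ (by linarith)]
  have h2 := Real.log_two_lt_d9
  rcases le_total b (9 / 2) with h | h
  · have := Real.log_le_sub_one_of_pos hb0
    nlinarith
  have hpow : ∀ k : ℕ, Real.log ((2 : ℝ) ^ k) = k * Real.log 2 := fun k => by rw [Real.log_pow]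
  rcases le_total b 30 with h' | h'
  · have h3 : Real.log b ≤ 5 * Real.log 2 := by
      have := Real.log_le_log hb0 (show b ≤ 2 ^ 5 by linarith)
      rw [hpow] at this
      exact_mod_cast this
    nlinarith
  · have h3 : Real.log b ≤ 7 * Real.log 2 + 11 / 64 := by
      have h4 := Real.log_le_sub_one_of_pos (show (0 : ℝ) < 150 / 2 ^ 7 by norm_num)
      rw [Real.log_div (by norm_num) (by norm_num), hpow] at h4
      have := Real.log_le_log hb0 hb'
      push_cast at h4
      linarith
    nlinarith

/-- The logarithm lies below its tangent at 300, and the convex function s/300 + 288/s is at most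
62/25 on this range. -/
theorem log_le_of_mem_Icc {s : ℝ} (hs : 150 ≤ s) (hs' : s ≤ 600) :
    Real.log s ≤ 36 / 5 - 288 / s := by
  have hs0 : 0 < s := by linarith
  have h1 := Real.log_le_sub_one_of_pos (show 0 < s / 300 by positivity)
  rw [Real.log_div hs0.ne' (by norm_num)] at h1
  have h2 : Real.log 300 ≤ 143 / 25 := by
    have h4 := Real.log_le_sub_one_of_pos (show (0 : ℝ) < 300 / 2 ^ 8 by norm_num)
    rw [Real.log_div (by norm_num) (by norm_num), Real.log_pow] at h4
    have := Real.log_two_lt_d9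
    push_cast at h4
    linarith
  have h3 : s / 300 + 288 / s ≤ 62 / 25 := by
    have h4 : 288 / s ≤ 62 / 25 - s / 300 := by
      rw [div_le_iff₀ hs0]
      nlinarith
    linarith
  linarith

/-- A choice of the sieve level for which Selberg's sieve yields a Brun--Titchmarsh bound. -/
theorem exists_sieve_level {b : ℝ} (hb : 1 < b) :
    ∃ z : ℕ, 1 < z ∧ (z : ℝ) ≤ b + 1 ∧ Real.log b ≤ 6 * selbergSum z ∧
      2 * b / 3 / selbergSum z + 2 * (sigmaSum z / selbergSum z) ^ 2 ≤ 4 * b / Real.log b := by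
  have hb0 : 0 < b := by linarith
  have hlog : 0 < Real.log b := Real.log_pos hb
  rcases le_total b 150 with hb' | hb'
  · have h := log_le_of_le_150 hb hb'
    refine ⟨2, by norm_num, by push_cast; linarith, ?_, ?_⟩
    · rw [selbergSum_two]
      refine h.trans ?_
      rw [div_le_iff₀ (by linarith)]
      linarith
    · rw [selbergSum_two, sigmaSum_two, le_div_iff₀ hlog]
      rw [le_div_iff₀ (by linarith)] at h
      linarith
  -- Since j ≤ √(b/150) < j + 1 ≤ 2j, the ratio s = b/j² falls in [150, 600].
  · set j := ⌊√(b / 150)⌋₊ with hj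
    have h1 : 1 ≤ √(b / 150) := by
      rw [Real.one_le_sqrt]
      linarith
    have hj1 : 1 ≤ j := Nat.le_floor (by exact_mod_cast h1)
    have hj1' : (1 : ℝ) ≤ j := by exact_mod_cast hj1
    have hj0 : (0 : ℝ) < j := by linarith
    have hsq : √(b / 150) ^ 2 = b / 150 := Real.sq_sqrt (by positivity)
    have hle : (j : ℝ) ≤ √(b / 150) := Nat.floor_le (by positivity)
    have hlt : √(b / 150) < j + 1 := Nat.lt_floor_add_one _
    have h2 : 150 * (j : ℝ) ^ 2 ≤ b := by nlinarith
    have h3 : b ≤ 600 * (j : ℝ) ^ 2 := by nlinarith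
    set s := b / (j : ℝ) ^ 2 with hs
    have hs1 : 150 ≤ s := by rw [hs, le_div_iff₀ (by positivity)]; exact h2
    have hs2 : s ≤ 600 := by rw [hs, div_le_iff₀ (by positivity)]; exact h3
    have hs0 : 0 < s := by linarith
    have hE := log_le_of_mem_Icc hs1 hs2
    have hlogs : Real.log s = Real.log b - 2 * Real.log j := by
      rw [hs, Real.log_div hb0.ne' (by positivity), Real.log_pow]
      push_cast
      ring
    have hL := le_selbergSum hj1
    have hS := sigmaSum_le j hj1
    set ℓ := Real.log b with hℓ
    -- D is six times the lower bound for L from `le_selbergSum`.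
    set D := 36 / 5 + 2 * Real.log j with hD
    have hlogj : 0 ≤ Real.log j := Real.log_nonneg hj1'
    have hD0 : 0 < D := by positivity
    have hDL : D ≤ 6 * selbergSum (6 * j) := by linarith
    have h288 : 0 < 288 / s := by positivity
    have hDℓ : ℓ + 288 / s ≤ D := by linarith
    refine ⟨6 * j, by omega, ?_, by linarith, ?_⟩
    · push_cast
      nlinarith
    · have hL0 : 0 < selbergSum (6 * j) := by linarith
      have hS0 : 0 ≤ sigmaSum (6 * j) :=
        sum_nonneg fun n _ => div_nonneg (sum_nonneg fun d _ => by positivity) (by positivity)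
      have h4 : 2 * b / 3 / selbergSum (6 * j) ≤ 4 * b / D := by
        rw [div_le_div_iff₀ hL0 hD0]
        linarith [mul_le_mul_of_nonneg_left hDL (show 0 ≤ 2 * b / 3 by positivity)]
      have h5 : sigmaSum (6 * j) / selbergSum (6 * j) ≤ 24 * j / D := by
        rw [div_le_div_iff₀ hL0 hD0]
        linarith [mul_le_mul hS hDL hD0.le (by positivity)]
      have h6 : (sigmaSum (6 * j) / selbergSum (6 * j)) ^ 2 ≤ (24 * j / D) ^ 2 := by gcongr
      have h7 : 2 * (24 * j / D) ^ 2 = 4 * b * (288 / s / D ^ 2) := by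
        rw [hs]
        field_simp
        ring
      -- With e = 288/s and ℓ ≤ D - e, one has ℓ(D + e) ≤ D² - e² ≤ D²: the excess of D over log b
      -- absorbs the sieve remainder.
      have h8 : 1 / D + 288 / s / D ^ 2 ≤ 1 / ℓ := by
        have h9 : 1 / D + 288 / s / D ^ 2 = (D + 288 / s) / D ^ 2 := by field_simp
        rw [h9, div_le_div_iff₀ (by positivity) hlog]
        nlinarith [mul_nonneg (sub_nonneg.2 hDℓ) (add_pos hD0 h288).le, sq_nonneg (288 / s)]
      calc _ ≤ 4 * b / D + 4 * b * (288 / s / D ^ 2) := by linarith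
        _ = 4 * b * (1 / D + 288 / s / D ^ 2) := by ring
        _ ≤ 4 * b * (1 / ℓ) := by gcongr
        _ = _ := by ring

end Level

/-! ### Equidistribution of monotone weights in multiples of m coprime to 6. -/

section Progressions

open Finset

/-- From N = ⌈a⌉ on, the sum exceeds the integral by an amount between 0 and G(N) ≤ G(a). The
missing piece of the integral, over [a, N], also lies between 0 and G(a). The two errors have
opposite signs, so they do not add up. -/
theorem abs_sum_int_sub_integral_le {G : ℝ → ℝ} {a U : ℝ} (haU : a ≤ U)
    (hanti : AntitoneOn G (Set.Ici a)) (h0 : ∀ t, a ≤ t → 0 ≤ G t) (hU : ∀ t, U ≤ t → G t = 0)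
    (s : Finset ℤ) (hs : ∀ n ∈ s, a ≤ n) (hs' : ∀ n : ℤ, a ≤ n → n ≤ U → n ∈ s) :
    |∑ n ∈ s, G n - ∫ t in a..U, G t| ≤ G a := by
  set N := ⌈a⌉ with hN
  have haN : a ≤ N := Int.le_ceil a
  have hN1 : (N : ℝ) < a + 1 := Int.ceil_lt_add_one a
  obtain ⟨K, hK⟩ := exists_nat_ge (U - N)
  let t : Finset ℤ := (range K).image fun i : ℕ => N + (i : ℤ)
  have hsum : ∑ n ∈ s, G n = ∑ i ∈ range K, G (N + i) := by
    have h1 : ∑ n ∈ t, G n = ∑ i ∈ range K, G (N + i) := by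
      rw [sum_image (fun i _ j _ h => by simpa using h)]
      push_cast
      rfl
    rw [← h1]
    have h2 : ∑ n ∈ s, G n = ∑ n ∈ s ∪ t, G n := by
      refine sum_subset subset_union_left fun n hn hns => hU _ ?_
      rcases mem_union.1 hn with h | h
      · exact absurd h hns
      · obtain ⟨i, -, rfl⟩ := mem_image.1 h
        by_contra! hlt
        refine hns (hs' _ ?_ hlt.le)
        push_cast
        linarith [Nat.cast_nonneg (α := ℝ) i]
    have h3 : ∑ n ∈ t, G n = ∑ n ∈ s ∪ t, G n := by
      refine sum_subset subset_union_right fun n hn hnt => hU _ ?_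
      rcases mem_union.1 hn with h | h
      · have h4 : N ≤ n := Int.ceil_le.2 (hs n h)
        by_contra! hlt
        refine hnt (mem_image.2 ⟨(n - N).toNat, mem_range.2 ?_, by omega⟩)
        have h5 : (n : ℝ) < N + K := by linarith
        have h6 : n < N + K := by exact_mod_cast h5
        omega
      · exact absurd h hnt
    rw [h2, h3]
  have hint : ∀ b c, a ≤ b → a ≤ c → IntervalIntegrable G volume b c := fun b c hb hc =>
    (hanti.mono fun u hu => (le_min hb hc).trans hu.1).intervalIntegrable
  have hNK : a ≤ N + K := by linarith [Nat.cast_nonneg (α := ℝ) K]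
  have hsplit : ∫ t in a..U, G t = (∫ t in a..N, G t) + ∫ t in (N : ℝ)..(N + K), G t := by
    have h1 := intervalIntegral.integral_add_adjacent_intervals (hint a N le_rfl haN)
      (hint N (N + K) haN hNK)
    have h2 := intervalIntegral.integral_add_adjacent_intervals (hint a U le_rfl haU)
      (hint U (N + K) haU hNK)
    have h3 : ∫ t in U..(N + K : ℝ), G t = 0 := by
      rw [intervalIntegral.integral_congr (g := fun _ => (0 : ℝ)), intervalIntegral.integral_zero]
      intro t ht
      rw [Set.uIcc_of_le (by linarith)] at ht
      exact hU t ht.1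
    linarith
  have hfirst0 : 0 ≤ ∫ t in a..N, G t :=
    intervalIntegral.integral_nonneg haN fun t ht => h0 t ht.1
  have hfirst1 : ∫ t in a..N, G t ≤ G a := by
    have h1 := intervalIntegral.norm_integral_le_of_norm_le_const (a := a) (b := N) (f := G)
      (C := G a) fun t ht => by
        rw [Set.uIoc_of_le haN] at ht
        rw [Real.norm_of_nonneg (h0 t ht.1.le)]
        exact hanti (Set.mem_Ici.2 le_rfl) ht.1.le ht.1.le
    rw [Real.norm_of_nonneg hfirst0, abs_of_nonneg (by linarith)] at h1
    nlinarith [h0 a le_rfl]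
  have hmono : AntitoneOn G (Set.Icc (N : ℝ) (N + K)) := hanti.mono fun u hu => haN.trans hu.1
  have hlow := hmono.integral_le_sum
  have hupp := hmono.sum_le_integral
  have hshift : ∑ i ∈ range K, G (N + i) + G (N + K) =
      ∑ i ∈ range K, G (N + ((i + 1 : ℕ) : ℝ)) + G N := by
    rw [← sum_range_succ (fun i : ℕ => G (N + i)), sum_range_succ']
    simp
  have hGN : G N ≤ G a := hanti (Set.mem_Ici.2 le_rfl) haN haN
  have hGK : 0 ≤ G (N + K) := h0 _ hNK
  rw [hsum, hsplit, abs_le]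
  constructor <;> linarith

theorem abs_sum_progression_sub_integral_le {g : ℝ → ℝ} {a U r q : ℝ} (hq : 0 < q) (haU : a ≤ U)
    (hanti : AntitoneOn g (Set.Ici a)) (h0 : ∀ t, a ≤ t → 0 ≤ g t) (hU : ∀ t, U ≤ t → g t = 0)
    (s : Finset ℤ) (hs : ∀ n ∈ s, a ≤ r + q * n)
    (hs' : ∀ n : ℤ, a ≤ r + q * n → r + q * n ≤ U → n ∈ s) :
    |∑ n ∈ s, g (r + q * n) - (∫ t in a..U, g t) / q| ≤ g a := by
  have hle : ∀ u v : ℝ, (u - r) / q ≤ v ↔ u ≤ r + q * v := fun u v => by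
    rw [div_le_iff₀ hq]
    constructor <;> intro h <;> linarith
  have hle' : ∀ u v : ℝ, v ≤ (u - r) / q ↔ r + q * v ≤ u := fun u v => by
    rw [le_div_iff₀ hq]
    constructor <;> intro h <;> linarith
  have hcancel : ∀ u : ℝ, r + q * ((u - r) / q) = u := fun u => by
    field_simp
    ring
  have h := abs_sum_int_sub_integral_le (G := fun u => g (r + q * u)) (a := (a - r) / q)
    (U := (U - r) / q) (by gcongr)
    (fun u hu v hv huv => hanti ((hle a u).1 hu) ((hle a v).1 hv) (by gcongr))
    (fun u hu => h0 _ ((hle a u).1 hu)) (fun u hu => hU _ ((hle U u).1 hu)) s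
    (fun n hn => (hle a n).2 (hs n hn))
    (fun n h1 h2 => hs' n ((hle a n).1 h1) ((hle' U n).1 h2))
  rw [intervalIntegral.integral_comp_add_mul _ hq.ne', hcancel, hcancel, smul_eq_mul] at h
  rwa [div_eq_inv_mul]

/-- As m is coprime to 6, the admissible multiples are mk with k ≡ 1 or 5 mod 6. These form two
progressions of modulus 6m, each with error at most g(a). -/
theorem abs_sum_multiples_sub_integral_le {g : ℝ → ℝ} {a U : ℝ} (haU : a ≤ U)
    (hanti : AntitoneOn g (Set.Ici a)) (h0 : ∀ t, a ≤ t → 0 ≤ g t) (hU : ∀ t, U ≤ t → g t = 0)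
    (B : Finset ℤ) (hB : ∀ n ∈ B, a ≤ n ∧ IsCoprime n 6)
    (hB' : ∀ n : ℤ, IsCoprime n 6 → a ≤ n → n ≤ U → n ∈ B) {m : ℕ} (hm : 0 < m)
    (hm6 : m.Coprime 6) :
    |∑ n ∈ B with (m : ℤ) ∣ n, g n - (∫ t in a..U, g t) / 3 / m| ≤ 2 * g a := by
  have hmR : (0 : ℝ) < m := by exact_mod_cast hm
  have hmZ : (m : ℤ) ≠ 0 := by exact_mod_cast hm.ne'
  have hm6' : IsCoprime (m : ℤ) 6 := by exact_mod_cast Nat.isCoprime_iff_coprime.2 hm6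
  have hmod : ∀ k : ℤ, IsCoprime k 6 ↔ k % 6 = 1 ∨ k % 6 = 5 := by
    intro k
    have h1 : IsCoprime k 6 ↔ IsCoprime (k % 6) 6 := by
      conv_lhs => rw [← Int.emod_add_mul_ediv k 6]
      exact IsCoprime.add_mul_left_left_iff (R := ℤ)
    rw [h1, Int.isCoprime_iff_gcd_eq_one]
    have h2 := Int.emod_nonneg k (by norm_num : (6 : ℤ) ≠ 0)
    have h3 := Int.emod_lt_of_pos k (by norm_num : (0 : ℤ) < 6)
    generalize k % 6 = l at *
    interval_cases l <;> norm_num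
  have key : ∀ r : ℤ, (r = 1 ∨ r = 5) →
      |∑ n ∈ B with ((m : ℤ) ∣ n ∧ n / m % 6 = r), g n - (∫ t in a..U, g t) / (6 * m)| ≤ g a := by
    intro r hr
    set C := {n ∈ B | (m : ℤ) ∣ n ∧ n / m % 6 = r} with hC
    let f : ℤ → ℤ := fun i => m * (r + 6 * i)
    have hf : Function.Injective f := fun i j hij => by
      have := mul_left_cancel₀ hmZ hij
      omega
    have hpre := sum_preimage f C hf.injOn (fun n => g n) (fun n hn hnf => by
      obtain ⟨-, ⟨k, rfl⟩, hk⟩ := mem_filter.1 hn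
      rw [Int.mul_ediv_cancel_left k hmZ] at hk
      exact absurd ⟨k / 6, by simp only [f]; congr 1; omega⟩ hnf)
    have hcast : ∀ i : ℤ, ((f i : ℤ) : ℝ) = (m * r : ℝ) + (6 * m) * i := fun i => by
      simp only [f]
      push_cast
      ring
    have h := abs_sum_progression_sub_integral_le (g := g) (a := a) (U := U) (r := m * r)
      (q := 6 * m) (by positivity) haU hanti h0 hU (C.preimage f hf.injOn)
      (fun i hi => by
        rw [← hcast]
        exact (hB _ (mem_filter.1 (mem_preimage.1 hi)).1).1)
      (fun i h1 h2 => by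
        rw [← hcast] at h1 h2
        have h3 : (r + 6 * i) % 6 = r := by omega
        refine mem_preimage.2 (mem_filter.2 ⟨hB' _ (hm6'.mul_left ((hmod _).2 ?_)) h1 h2,
          dvd_mul_right _ _, ?_⟩)
        · rw [h3]
          exact hr
        · rw [Int.mul_ediv_cancel_left _ hmZ, h3])
    simp_rw [← hcast] at h
    rwa [hpre] at h
  have hsplit : ∑ n ∈ B with (m : ℤ) ∣ n, g n =
      ∑ n ∈ B with ((m : ℤ) ∣ n ∧ n / m % 6 = 1), g n +
        ∑ n ∈ B with ((m : ℤ) ∣ n ∧ n / m % 6 = 5), g n := by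
    rw [← sum_union (disjoint_filter.2 fun n _ h1 h2 => by omega), ← filter_or]
    refine sum_congr (filter_congr fun n hn => ?_) fun _ _ => rfl
    constructor
    · rintro ⟨k, rfl⟩
      have h1 := (hmod k).1 ((hB _ hn).2.of_mul_left_right)
      rw [Int.mul_ediv_cancel_left k hmZ]
      rcases h1 with h1 | h1 <;> simp [h1]
    · rintro (h | h) <;> exact h.1
  have h1 := abs_le.1 (key 1 (Or.inl rfl))
  have h5 := abs_le.1 (key 5 (Or.inr rfl))
  have hI : (∫ t in a..U, g t) / 3 / m = (∫ t in a..U, g t) / (6 * m) +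
      (∫ t in a..U, g t) / (6 * m) := by
    field_simp
    ring
  rw [hsplit, hI, abs_le]
  constructor <;> linarith [h1.1, h1.2, h5.1, h5.2]

/-- Selberg's sieve for the primes `p` with `σ p ∈ [a, U]`, `σ = ± 1`, weighted with an antitone
function of `σ p`. -/
theorem sum_primes_le_of_antitone {z : ℕ} (hz : 1 < z) {σ : ℤ} (hσ : σ = 1 ∨ σ = -1)
    {g : ℝ → ℝ} {a U : ℝ} (haU : a ≤ U)
    (hanti : AntitoneOn g (Set.Ici a)) (h0 : ∀ t, a ≤ t → 0 ≤ g t) (hU : ∀ t, U ≤ t → g t = 0)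
    (A : Finset ℕ) (hA : ∀ n ∈ A, a ≤ σ * n ∧ n.Coprime 6)
    (hA' : ∀ n : ℤ, IsCoprime n 6 → a ≤ n → n ≤ U → ∃ k ∈ A, σ * k = n) :
    ∑ n ∈ A with n.Prime ∧ z ≤ n, g (σ * n) ≤
      (∫ t in a..U, g t) / 3 / selbergSum z + 2 * g a * (sigmaSum z / selbergSum z) ^ 2 := by
  have hσ0 : σ ≠ 0 := by rcases hσ with rfl | rfl <;> norm_num
  have hσu : IsUnit σ := by rcases hσ with rfl | rfl <;> simp
  have hinj : Function.Injective fun n : ℕ => σ * (n : ℤ) := fun i j h => by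
    have := mul_left_cancel₀ hσ0 h
    exact_mod_cast this
  obtain ⟨e, he⟩ : ∃ e : ℕ ↪ ℤ, ∀ n, e n = σ * n := ⟨⟨_, hinj⟩, fun _ => rfl⟩
  refine selberg_upper_bound hz A (fun n => g (σ * n)) (fun n hn => h0 _ (hA n hn).1)
    fun m hm hm6 => ?_
  have h := abs_sum_multiples_sub_integral_le haU hanti h0 hU (A.map e) (fun n hn => by
      obtain ⟨k, hk, rfl⟩ := mem_map.1 hn
      rw [he]
      refine ⟨by simpa using (hA k hk).1, ?_⟩
      have h6 : IsCoprime (k : ℤ) 6 := by exact_mod_cast Nat.isCoprime_iff_coprime.2 (hA k hk).2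
      exact (isCoprime_mul_unit_left_left hσu _ _).2 h6)
    (fun n h1 h2 h3 => by
      obtain ⟨k, hk, rfl⟩ := hA' n h1 h2 h3
      exact mem_map.2 ⟨k, hk, he k⟩) hm hm6
  rw [sum_filter, sum_map] at h
  rw [sum_filter]
  have hdvd : ∀ n : ℕ, (m : ℤ) ∣ σ * n ↔ m ∣ n := fun n => by
    rw [hσu.dvd_mul_left, Int.natCast_dvd_natCast]
  simp only [he, hdvd, Int.cast_mul, Int.cast_natCast] at h
  exact h

end Progressions

/-! ### Sign, monotonicity and size of the kernel functions and of the weight M. -/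

section Kernel

theorem besselI0_term_nonneg (y : ℝ) (n : ℕ) :
    0 ≤ (y / 2) ^ (2 * n) / ((n.factorial : ℝ) ^ 2) := by
  rw [pow_mul]
  positivity

theorem besselI0_term_le (y : ℝ) (n : ℕ) :
    (y / 2) ^ (2 * n) / ((n.factorial : ℝ) ^ 2) ≤ ((y / 2) ^ 2) ^ n / n.factorial := by
  rw [pow_mul]
  have h1 : (1 : ℝ) ≤ n.factorial := by exact_mod_cast n.factorial_pos
  gcongr
  nlinarith

theorem summable_besselI0 (y : ℝ) :
    Summable fun n : ℕ => (y / 2) ^ (2 * n) / ((n.factorial : ℝ) ^ 2) :=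
  Summable.of_nonneg_of_le (besselI0_term_nonneg y) (besselI0_term_le y)
    (Real.summable_pow_div_factorial _)

theorem besselI0_nonneg (y : ℝ) : 0 ≤ besselI0 y := tsum_nonneg (besselI0_term_nonneg y)

theorem besselI0_le_of_abs_le {y c : ℝ} (h : |y| ≤ |c|) : besselI0 y ≤ besselI0 c := by
  refine (summable_besselI0 y).tsum_le_tsum (fun n => ?_) (summable_besselI0 c)
  rw [pow_mul, pow_mul]
  have h1 : (y / 2) ^ 2 ≤ (c / 2) ^ 2 := by
    have := sq_le_sq.2 h
    linarith
  gcongr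

theorem measurable_besselI0 : Measurable besselI0 := by
  refine measurable_of_tendsto_metrizable
    (f := fun N y => ∑ n ∈ Finset.range N, (y / 2) ^ (2 * n) / ((n.factorial : ℝ) ^ 2))
    (fun N => by fun_prop) ?_
  rw [tendsto_pi_nhds]
  exact fun y => (summable_besselI0 y).hasSum.tendsto_sum_nat

theorem measurable_chiStar (A : Set ℝ) : Measurable (chiStar A) :=
  Measurable.ite isOpen_interior.measurableSet measurable_const
    (Measurable.ite isClosed_frontier.measurableSet measurable_const measurable_const)

theorem chiStar_nonneg (A : Set ℝ) (t : ℝ) : 0 ≤ chiStar A t := by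
  rw [chiStar]
  split_ifs <;> norm_num

theorem chiStar_le_one (A : Set ℝ) (t : ℝ) : chiStar A t ≤ 1 := by
  rw [chiStar]
  split_ifs <;> norm_num

theorem chiStar_eq_zero {y : ℝ} (hy : y ∉ Set.Icc (-1 : ℝ) 1) : chiStar (Set.Icc (-1) 1) y = 0 := by
  have h1 : y ∉ interior (Set.Icc (-1 : ℝ) 1) := fun h => hy (interior_subset h)
  have h2 : y ∉ frontier (Set.Icc (-1 : ℝ) 1) := fun h => hy (isClosed_Icc.frontier_subset h)
  rw [chiStar, if_neg h1, if_neg h2]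

theorem eta_eq_zero {c y : ℝ} (hy : y ∉ Set.Icc (-1 : ℝ) 1) : eta c y = 0 := by
  rw [eta, chiStar_eq_zero hy]
  ring

theorem const_pos {c : ℝ} (hc : 0 < c) : 0 < c / (2 * Real.sinh c) := by
  have := Real.sinh_pos_iff.2 hc
  positivity

theorem eta_nonneg {c : ℝ} (hc : 0 < c) (y : ℝ) : 0 ≤ eta c y :=
  mul_nonneg (mul_nonneg (chiStar_nonneg _ _) (const_pos hc).le) (besselI0_nonneg _)

theorem measurable_eta (c : ℝ) : Measurable (eta c) := by
  refine ((measurable_chiStar _).mul measurable_const).mul (measurable_besselI0.comp ?_)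
  fun_prop

theorem eta_le {c : ℝ} (hc : 0 < c) (y : ℝ) :
    eta c y ≤ c / (2 * Real.sinh c) * besselI0 c := by
  have h1 : |c * √(1 - y ^ 2)| ≤ |c| := by
    rw [abs_mul, abs_of_nonneg (Real.sqrt_nonneg _)]
    refine mul_le_of_le_one_right (abs_nonneg c) (Real.sqrt_le_one.2 ?_)
    nlinarith
  have h2 := besselI0_le_of_abs_le h1
  have h3 := chiStar_le_one (Set.Icc (-1) 1) y
  have h4 := const_pos hc
  rw [eta]
  refine mul_le_mul ?_ h2 (besselI0_nonneg _) h4.le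
  exact mul_le_of_le_one_left h4.le h3

theorem integrable_of_bounded_support {f : ℝ → ℝ} (hf : Measurable f) {C : ℝ}
    (hC : ∀ y, |f y| ≤ C) (h0 : ∀ y, y ∉ Set.Icc (-1 : ℝ) 1 → f y = 0) : Integrable f := by
  have h1 : IntegrableOn f (Set.Icc (-1) 1) :=
    Measure.integrableOn_of_bounded (M := C) (by simp) hf.aestronglyMeasurable
      (Filter.Eventually.of_forall hC)
  exact (integrableOn_iff_integrable_of_support_subset fun y hy => by
    by_contra h
    exact hy (h0 y h)).1 h1

theorem integrable_eta {c : ℝ} (hc : 0 < c) : Integrable (eta c) :=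
  integrable_of_bounded_support (measurable_eta c)
    (fun y => (abs_of_nonneg (eta_nonneg hc y)).trans_le (eta_le hc y)) fun _ => eta_eq_zero

/-- The distribution function of `η_c`. -/
def etaCdf (c t : ℝ) : ℝ := ∫ τ in Set.Iic t, eta c τ

theorem etaCdf_nonneg {c : ℝ} (hc : 0 < c) (t : ℝ) : 0 ≤ etaCdf c t :=
  setIntegral_nonneg measurableSet_Iic fun y _ => eta_nonneg hc y

theorem etaCdf_mono {c : ℝ} (hc : 0 < c) : Monotone (etaCdf c) := fun _ _ h =>
  setIntegral_mono_set (integrable_eta hc).integrableOn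
    (Filter.Eventually.of_forall (eta_nonneg hc)) (Set.Iic_subset_Iic.2 h).eventuallyLE

theorem etaCdf_eq_zero {c t : ℝ} (ht : t ≤ -1) : etaCdf c t = 0 := by
  rw [etaCdf, integral_Iic_eq_integral_Iio]
  exact setIntegral_eq_zero_of_forall_eq_zero fun y hy => eta_eq_zero fun h => by
    have := h.1
    have : y < t := hy
    linarith

theorem etaCdf_le {c : ℝ} (hc : 0 < c) (t : ℝ) : etaCdf c t ≤ ∫ y, eta c y :=
  setIntegral_le_integral (integrable_eta hc) (Filter.Eventually.of_forall (eta_nonneg hc))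

theorem setIntegral_Iic_comp_div {ε : ℝ} (hε : 0 < ε) (f : ℝ → ℝ) (t : ℝ) :
    ∫ τ in Set.Iic t, f (τ / ε) = ε * ∫ τ in Set.Iic (t / ε), f τ := by
  rw [← integral_indicator measurableSet_Iic, ← integral_indicator measurableSet_Iic,
    ← abs_of_pos hε, ← smul_eq_mul, abs_of_pos hε]
  have h := Measure.integral_comp_div ((Set.Iic (t / ε)).indicator f) ε
  rw [abs_of_pos hε] at h
  rw [← h]
  congr 1
  ext τ
  have : τ / ε ≤ t / ε ↔ τ ≤ t := div_le_div_iff_of_pos_right hε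
  by_cases hτ : τ ≤ t <;> simp [Set.indicator, this, hτ]

theorem setIntegral_etaEps {c ε : ℝ} (hε : 0 < ε) (t : ℝ) :
    ∫ τ in Set.Iic t, etaEps c ε τ = etaCdf c (t / ε) := by
  simp only [etaEps]
  rw [integral_const_mul, setIntegral_Iic_comp_div hε, etaCdf]
  field_simp

theorem muEps_eq_etaCdf {c ε : ℝ} (hε : 0 < ε) (t : ℝ) :
    muEps c ε t = if t < 0 then -etaCdf c (t / ε) else if 0 < t then etaCdf c (-t / ε) else 0 := by
  simp only [muEps, setIntegral_etaEps hε]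

theorem mu_eq_etaCdf (c t : ℝ) :
    mu c t = if t < 0 then -etaCdf c t else if 0 < t then etaCdf c (-t) else 0 := by
  rw [mu, muEps_eq_etaCdf one_pos, div_one, div_one]

theorem muEps_eq {c ε : ℝ} (hε : 0 < ε) (t : ℝ) : muEps c ε t = mu c (t / ε) := by
  rw [muEps_eq_etaCdf hε, mu_eq_etaCdf, neg_div]
  simp only [div_neg_iff, div_pos_iff, hε, hε.not_gt, and_true, and_false, or_false, false_or]

theorem nuEps_eq {c ε : ℝ} (hε : 0 < ε) (t : ℝ) : nuEps c ε t = ε * nu c (t / ε) := by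
  simp only [nuEps, nu, muEps_eq hε]
  rw [setIntegral_Iic_comp_div hε]
  rfl

theorem mu_of_pos {c t : ℝ} (ht : 0 < t) : mu c t = etaCdf c (-t) := by
  rw [mu_eq_etaCdf, if_neg ht.not_gt, if_pos ht]

theorem mu_neg (c t : ℝ) : mu c (-t) = -mu c t := by
  rw [mu_eq_etaCdf, mu_eq_etaCdf, neg_neg]
  rcases lt_trichotomy t 0 with h | rfl | h
  · simp [h, h.not_gt]
  · simp
  · simp [h, h.not_gt]

theorem mu_nonneg {c t : ℝ} (hc : 0 < c) (ht : 0 < t) : 0 ≤ mu c t := by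
  rw [mu_of_pos ht]
  exact etaCdf_nonneg hc _

theorem mu_eq_zero {c t : ℝ} (ht : 1 ≤ t) : mu c t = 0 := by
  rw [mu_of_pos (by linarith), etaCdf_eq_zero (by linarith)]

theorem mu_antitoneOn {c : ℝ} (hc : 0 < c) : AntitoneOn (mu c) (Set.Ioi 0) :=
  fun s hs t ht hst => by
    rw [mu_of_pos hs, mu_of_pos ht]
    exact etaCdf_mono hc (neg_le_neg hst)

theorem measurable_mu {c : ℝ} (hc : 0 < c) : Measurable (mu c) := by
  rw [show mu c = fun t => _ from funext (mu_eq_etaCdf c)]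
  have h := (etaCdf_mono hc).measurable
  exact Measurable.ite measurableSet_Iio h.neg
    (Measurable.ite measurableSet_Ioi (h.comp measurable_neg) measurable_const)

theorem integrable_mu {c : ℝ} (hc : 0 < c) : Integrable (mu c) := by
  refine integrable_of_bounded_support (measurable_mu hc) (C := ∫ y, eta c y) (fun t => ?_)
    fun t ht => ?_
  · have h1 := etaCdf_le hc
    have h2 := etaCdf_nonneg hc
    rw [mu_eq_etaCdf]
    split_ifs
    · rw [abs_neg, abs_of_nonneg (h2 _)]
      exact h1 _
    · rw [abs_of_nonneg (h2 _)]
      exact h1 _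
    · rw [abs_zero]
      exact (h2 0).trans (h1 0)
  · rcases le_total 0 t with h | h
    · exact mu_eq_zero (by by_contra! h'; exact ht ⟨by linarith, h'.le⟩)
    · rw [← neg_neg t, mu_neg, mu_eq_zero, neg_zero]
      by_contra! h'
      exact ht ⟨by linarith, by linarith⟩

theorem nu_neg_eq {c u : ℝ} (hc : 0 < c) (hu1 : u ≤ 1) :
    nu c (-u) = -∫ t in u..1, mu c t := by
  have h1 : nu c (-u) = ∫ t in Set.Iic (-u), mu c t := rfl
  have h2 : ∫ t in Set.Iic (-u), mu c t = -∫ t in Set.Ioi u, mu c t := by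
    have := integral_comp_neg_Iic (-u) (mu c)
    rw [neg_neg] at this
    rw [← this, ← integral_neg]
    simp only [mu_neg, neg_neg]
  rw [h1, h2, intervalIntegral.integral_of_le hu1]
  have h3 : Set.Ioi u = Set.Ioc u 1 ∪ Set.Ioi 1 := (Set.Ioc_union_Ioi_eq_Ioi hu1).symm
  have hi := integrable_mu hc
  rw [h3, setIntegral_union (Set.Ioc_disjoint_Ioi le_rfl) measurableSet_Ioi hi.integrableOn
    hi.integrableOn, setIntegral_eq_zero_of_forall_eq_zero (t := Set.Ioi (1 : ℝ)), add_zero]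
  exact fun t ht => mu_eq_zero (le_of_lt ht)

theorem nu_even {c : ℝ} (hc : 0 < c) (u : ℝ) : nu c u = nu c (-u) := by
  have hi := integrable_mu hc
  have h1 : nu c u = ∫ t in Set.Iic u, mu c t := rfl
  have h2 : nu c (-u) = ∫ t in Set.Iic (-u), mu c t := rfl
  have h3 := intervalIntegral.integral_Iic_sub_Iic (f := mu c) (a := -u) (b := u)
    hi.integrableOn hi.integrableOn
  have h4 : ∫ t in -u..u, mu c t = 0 := by
    have h5 := intervalIntegral.integral_comp_neg (a := -u) (b := u) (mu c)
    simp only [mu_neg, neg_neg, intervalIntegral.integral_neg] at h5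
    linarith
  rw [h1, h2]
  linarith

/-- This identity makes |ν_c(α)| appear as the total mass of the sieve weight. -/
theorem abs_nu_eq {c u : ℝ} (hc : 0 < c) (hu : 0 < u) (hu1 : u ≤ 1) :
    |nu c u| = ∫ t in u..1, mu c t := by
  rw [nu_even hc u, nu_neg_eq hc hu1, abs_neg, abs_of_nonneg]
  exact intervalIntegral.integral_nonneg hu1 fun t ht => mu_nonneg hc (hu.trans_le ht.1)

theorem abs_nu_le {c u : ℝ} (hc : 0 < c) (hu : 0 < u) (hu1 : u ≤ 1) :
    |nu c u| ≤ (1 - u) * mu c u := by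
  rw [abs_nu_eq hc hu hu1]
  have h := intervalIntegral.integral_mono_on (f := mu c) (g := fun _ => mu c u) hu1
    (integrable_mu hc).intervalIntegrable intervalIntegrable_const
    fun t ht => mu_antitoneOn hc hu (hu.trans_le ht.1) ht.1
  rwa [intervalIntegral.integral_const, smul_eq_mul] at h

/-- λ is the ratio of sinh(s)/s to sinh(c)/c with s = √(c² + ε²/4) ≥ c, and sinh(s)/s increases
because sinh is convex on the positive axis. -/
theorem one_le_lam {c ε : ℝ} (hc : 0 < c) : 1 ≤ lam c ε := by
  rw [lam, logan_half_I c ε hc.ne', Complex.ofReal_re]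
  set s := √(c ^ 2 + ε ^ 2 / 4) with hs
  have hcs : c ≤ s := Real.le_sqrt_of_sq_le (by nlinarith [sq_nonneg ε])
  have hconv : ConvexOn ℝ (Set.Ici (0 : ℝ)) Real.sinh := by
    refine MonotoneOn.convexOn_of_deriv (convex_Ici 0) Real.continuous_sinh.continuousOn
      Real.differentiable_sinh.differentiableOn ?_
    rw [Real.deriv_sinh, interior_Ici]
    intro x hx y hy hxy
    rw [Real.cosh_le_cosh, abs_of_pos hx, abs_of_pos hy]
    exact hxy
  have hs0 : 0 < s := hc.trans_le hcs
  have h := hconv.secant_mono (a := 0) (x := c) (y := s) (Set.mem_Ici.2 le_rfl) hc.le hs0.le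
    hc.ne' hs0.ne' hcs
  simp only [Real.sinh_zero, sub_zero] at h
  have hsinh := Real.sinh_pos_iff.2 hc
  calc (1 : ℝ) = c / Real.sinh c * (Real.sinh c / c) := by field_simp
    _ ≤ _ := by gcongr

/-- The second bracket is at most εuμ_c(u) + ε(1-u)μ_c(u) = εμ_c(u), and log t ≥ 2 keeps its
coefficient within 1/2. -/
theorem abs_weightM_le {x c ε t : ℝ} (hc : 0 < c) (hε : 0 < ε) (ht : 2 ≤ Real.log t) {u : ℝ}
    (hu : 0 < u) (hu1 : u ≤ 1) (htu : |Real.log (t / x)| = ε * u) :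
    |weightM x c ε t| ≤ (1 + ε / 2) * mu c u := by
  have hlam := one_le_lam (ε := ε) hc
  have hmu := mu_nonneg hc hu
  have hmuabs : |muEps c ε (Real.log (t / x))| = mu c u := by
    rw [muEps_eq hε]
    rcases (abs_eq (by positivity)).1 htu with h | h
    · rw [h, mul_div_cancel_left₀ _ hε.ne', abs_of_nonneg hmu]
    · rw [h, neg_div, mul_div_cancel_left₀ _ hε.ne', mu_neg, abs_neg, abs_of_nonneg hmu]
  have hnuabs : |nuEps c ε (Real.log (t / x))| = ε * |nu c u| := by
    rw [nuEps_eq hε, abs_mul, abs_of_pos hε]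
    rcases (abs_eq (by positivity)).1 htu with h | h
    · rw [h, mul_div_cancel_left₀ _ hε.ne']
    · rw [h, neg_div, mul_div_cancel_left₀ _ hε.ne', ← nu_even hc u]
  have hcoef : |1 / Real.log t - 1 / 2| ≤ 1 / 2 := by
    have h1 : 0 < 1 / Real.log t := by positivity
    have h2 : 1 / Real.log t ≤ 1 / 2 := one_div_le_one_div_of_le two_pos ht
    rw [abs_le]
    constructor <;> linarith
  have hinner : |muEps c ε (Real.log (t / x)) * Real.log (t / x) -
      nuEps c ε (Real.log (t / x))| ≤ ε * mu c u := by
    refine (abs_sub _ _).trans ?_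
    rw [abs_mul, hmuabs, hnuabs, htu]
    nlinarith [abs_nu_le hc hu hu1]
  rw [weightM, abs_mul, abs_of_pos (inv_pos.2 (by linarith))]
  have h1 : (lam c ε)⁻¹ ≤ 1 := inv_le_one_of_one_le₀ hlam
  refine (mul_le_of_le_one_left (abs_nonneg _) h1).trans ((abs_add_le _ _).trans ?_)
  rw [abs_mul, hmuabs]
  have := mul_le_mul hcoef hinner (abs_nonneg _) (by norm_num)
  linarith

end Kernel

/-! ### Higher prime powers, and the sieve on the outer intervals. -/

section OuterIntervals

open Finset

theorem sum_inv_Icc_two_le_log {M : ℕ} (hM : 1 ≤ M) :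
    ∑ m ∈ Icc 2 M, 1 / (m : ℝ) ≤ Real.log M := by
  induction M, hM using Nat.le_induction with
  | base => simp
  | succ M hM ih =>
    have hM0 : (0 : ℝ) < M := by exact_mod_cast hM
    rw [sum_Icc_succ_top (by omega)]
    have h := Real.one_sub_inv_le_log_of_pos (show (0 : ℝ) < ((M + 1 : ℕ) : ℝ) / M by positivity)
    rw [Real.log_div (by positivity) hM0.ne'] at h
    have h2 : 1 - (((M + 1 : ℕ) : ℝ) / M)⁻¹ = 1 / ((M + 1 : ℕ) : ℝ) := by
      push_cast
      field_simp
      ring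
    linarith

theorem sum_inv_sq_Icc_two_le_one {M : ℕ} (hM : 1 ≤ M) :
    ∑ m ∈ Icc 2 M, 1 / (m : ℝ) ^ 2 ≤ 1 - 1 / (M : ℝ) := by
  induction M, hM using Nat.le_induction with
  | base => simp
  | succ M hM ih =>
    have hM0 : (0 : ℝ) < M := by exact_mod_cast hM
    rw [sum_Icc_succ_top (by omega)]
    have h : 1 / ((M + 1 : ℕ) : ℝ) ^ 2 ≤ 1 / M - 1 / ((M + 1 : ℕ) : ℝ) := by
      push_cast
      rw [div_sub_div _ _ hM0.ne' (by positivity), div_le_div_iff₀ (by positivity) (by positivity)]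
      nlinarith
    linarith

/-- For the extreme bases a ≤ b, Bernoulli gives 1 + m(b-a)/a ≤ (b/a)^m ≤ 1 + δ. Moreover a ≤ √r
because m ≥ 2. -/
theorem card_le_of_pow_mem {s : Finset ℕ} {m : ℕ} {δ r : ℝ} (hm : 2 ≤ m) (hδ : 0 ≤ δ)
    (hpos : ∀ n ∈ s, 1 ≤ n) (hratio : ∀ n ∈ s, ∀ k ∈ s, (k : ℝ) ^ m ≤ (1 + δ) * (n : ℝ) ^ m)
    (hr : ∀ n ∈ s, (n : ℝ) ^ m ≤ r) : (#s : ℝ) ≤ 1 + δ * √r / m := by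
  have hm0 : (0 : ℝ) < m := by exact_mod_cast (by omega : 0 < m)
  rcases s.eq_empty_or_nonempty with rfl | hne
  · simp only [card_empty, Nat.cast_zero]
    positivity
  set a := s.min' hne with ha
  set b := s.max' hne with hb
  have has := s.min'_mem hne
  have hbs := s.max'_mem hne
  have ha1 : (1 : ℝ) ≤ a := by exact_mod_cast hpos _ has
  have ha0 : (0 : ℝ) < a := by linarith
  have hab : a ≤ b := s.min'_le _ hbs
  have hcard : #s ≤ b + 1 - a := by
    rw [← Nat.card_Icc]
    exact card_le_card fun n hn => mem_Icc.2 ⟨s.min'_le _ hn, s.le_max' _ hn⟩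
  have hcard' : (#s : ℝ) ≤ 1 + ((b : ℝ) - a) := by
    have : #s + a ≤ b + 1 := by omega
    have : (#s : ℝ) + a ≤ b + 1 := by exact_mod_cast this
    linarith
  have hab' : (a : ℝ) ≤ b := by exact_mod_cast hab
  have hbern := one_add_mul_le_pow (a := ((b : ℝ) - a) / a)
    (by have := div_nonneg (sub_nonneg.2 hab') ha0.le; linarith) m
  have h1 : 1 + ((b : ℝ) - a) / a = b / a := by
    field_simp
    ring
  rw [h1, div_pow] at hbern
  have h2 : (b : ℝ) ^ m / (a : ℝ) ^ m ≤ 1 + δ := by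
    rw [div_le_iff₀ (by positivity)]
    exact hratio _ has _ hbs
  have h3 : (m : ℝ) * (((b : ℝ) - a) / a) ≤ δ := by linarith
  have h4 : (a : ℝ) ≤ √r :=
    Real.le_sqrt_of_sq_le ((pow_le_pow_right₀ ha1 hm).trans (hr _ has))
  have h5 : (b : ℝ) - a ≤ δ * a / m := by
    rw [le_div_iff₀ hm0]
    rw [← mul_div_assoc, div_le_iff₀ ha0] at h3
    linarith
  have h6 : δ * a / m ≤ δ * √r / m := by gcongr
  linarith

/-- The contribution of the higher powers in a short interval. -/
theorem sum_higher_powers_le {T : Finset (ℕ × ℕ)} {M : ℕ} {δ r : ℝ} (hδ : 0 ≤ δ) (hM : 1 ≤ M)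
    (hT : ∀ q ∈ T, 1 ≤ q.1 ∧ 2 ≤ q.2 ∧ q.2 ≤ M ∧ (q.1 : ℝ) ^ q.2 ≤ r)
    (hratio : ∀ q ∈ T, ∀ q' ∈ T, (q'.1 : ℝ) ^ q'.2 ≤ (1 + δ) * (q.1 : ℝ) ^ q.2) :
    ∑ q ∈ T, 1 / (q.2 : ℝ) ≤ Real.log M + δ * √r := by
  have hmaps : ∀ q ∈ T, q.2 ∈ Icc 2 M := fun q hq =>
    mem_Icc.2 ⟨(hT q hq).2.1, (hT q hq).2.2.1⟩
  rw [← sum_fiberwise_of_maps_to hmaps]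
  have h1 : ∀ m ∈ Icc 2 M, ∑ q ∈ T with q.2 = m, 1 / (q.2 : ℝ) ≤
      1 / (m : ℝ) + δ * √r * (1 / (m : ℝ) ^ 2) := by
    intro m hm
    have hm2 := (mem_Icc.1 hm).1
    have hm0 : (0 : ℝ) < m := by exact_mod_cast (by omega : 0 < m)
    set Tm : Finset (ℕ × ℕ) := {q ∈ T | q.2 = m} with hTm
    have hTm' : ∀ q ∈ Tm, q ∈ T ∧ q.2 = m := fun q hq => mem_filter.1 hq
    have hsum : ∑ q ∈ Tm, 1 / (q.2 : ℝ) = (#Tm : ℝ) * (1 / (m : ℝ)) := by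
      rw [← nsmul_eq_mul]
      exact sum_eq_card_nsmul fun q hq => by rw [(hTm' q hq).2]
    set Pm : Finset ℕ := Tm.image Prod.fst with hPm
    have hcard : #Pm = #Tm := card_image_of_injOn fun q hq q' hq' h =>
      Prod.ext h ((hTm' q hq).2.trans (hTm' q' hq').2.symm)
    have hmem : ∀ n ∈ Pm, (n, m) ∈ T := by
      intro n hn
      obtain ⟨q, hq, rfl⟩ := mem_image.1 hn
      obtain ⟨hq1, hq2⟩ := hTm' q hq
      rwa [← hq2]
    have h2 : (#Pm : ℝ) ≤ 1 + δ * √r / m := card_le_of_pow_mem hm2 hδ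
      (fun n hn => (hT _ (hmem n hn)).1)
      (fun n hn k hk => hratio _ (hmem n hn) _ (hmem k hk))
      (fun n hn => (hT _ (hmem n hn)).2.2.2)
    rw [hcard] at h2
    rw [hsum]
    calc (#Tm : ℝ) * (1 / (m : ℝ)) ≤ (1 + δ * √r / m) * (1 / (m : ℝ)) := by gcongr
      _ = 1 / (m : ℝ) + δ * √r * (1 / (m : ℝ) ^ 2) := by
        field_simp
  refine (sum_le_sum h1).trans ?_
  rw [sum_add_distrib, ← mul_sum]
  have h2 := sum_inv_Icc_two_le_log hM
  have h3 := sum_inv_sq_Icc_two_le_one hM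
  have h4 : 0 ≤ 1 / (M : ℝ) := by positivity
  have h5 : 0 ≤ δ * √r := by positivity
  nlinarith

/-- The parametrization `u ↦ σ x e^{σ ε u}` of the reflected outer interval. -/
def shell (x ε : ℝ) (σ : ℤ) (u : ℝ) : ℝ := σ * (x * Real.exp (σ * (ε * u)))

theorem hasDerivAt_shell (x ε : ℝ) {σ : ℤ} (hσ : σ = 1 ∨ σ = -1) (u : ℝ) :
    HasDerivAt (shell x ε σ) (ε * x * Real.exp (σ * (ε * u))) u := by
  have h1 : HasDerivAt (fun u : ℝ => (σ : ℝ) * (ε * u)) (σ * (ε * 1)) u :=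
    ((hasDerivAt_id u).const_mul ε).const_mul (σ : ℝ)
  have h2 := (h1.exp.const_mul x).const_mul (σ : ℝ)
  convert! h2 using 1
  have : (σ : ℝ) * σ = 1 := by rcases hσ with rfl | rfl <;> norm_num
  linear_combination (-(ε * x * Real.exp (σ * (ε * u)))) * this

/-- On the lower interval μ_c increases with t; reflecting by σ = -1 makes the weight decreasing
there too, so both intervals share one argument. -/
theorem strictMono_shell {x ε : ℝ} (hx : 0 < x) (hε : 0 < ε) {σ : ℤ} (hσ : σ = 1 ∨ σ = -1) :
    StrictMono (shell x ε σ) :=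
  strictMono_of_hasDerivAt_pos (hasDerivAt_shell x ε hσ) fun u => by positivity

theorem continuous_shell (x ε : ℝ) (σ : ℤ) : Continuous (shell x ε σ) := by
  unfold shell
  fun_prop

theorem exists_shell_eq {x ε α t : ℝ} {σ : ℤ} (hα : α ≤ 1)
    (h1 : shell x ε σ α ≤ t) (h2 : t ≤ shell x ε σ 1) :
    ∃ u, α ≤ u ∧ u ≤ 1 ∧ shell x ε σ u = t := by
  obtain ⟨u, hu, rfl⟩ :=
    intermediate_value_Icc hα (continuous_shell x ε σ).continuousOn ⟨h1, h2⟩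
  exact ⟨u, hu.1, hu.2, rfl⟩

theorem shell_eq_iff {x ε t u : ℝ} {σ : ℤ} (hσ : σ = 1 ∨ σ = -1) :
    shell x ε σ u = σ * t ↔ t = x * Real.exp (σ * (ε * u)) := by
  have : (σ : ℝ) ≠ 0 := by rcases hσ with rfl | rfl <;> norm_num
  rw [shell, mul_right_inj' this, eq_comm]

theorem abs_log_div_of_eq {x ε t u : ℝ} {σ : ℤ} (hσ : σ = 1 ∨ σ = -1) (hx : 0 < x) (hε : 0 < ε)
    (hu : 0 < u) (ht : t = x * Real.exp (σ * (ε * u))) : |Real.log (t / x)| = ε * u := by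
  rw [ht, mul_div_cancel_left₀ _ hx.ne', Real.log_exp, abs_mul, abs_of_pos (mul_pos hε hu)]
  rcases hσ with rfl | rfl <;> simp

open Classical in
/-- The sieve weight `μ_c`, transported along `shell`. -/
def shellWeight (c x ε : ℝ) (σ : ℤ) (t : ℝ) : ℝ :=
  if t < shell x ε σ 1 then mu c (|Real.log (σ * t / x)| / ε) else 0

theorem shellWeight_shell {c x ε u : ℝ} {σ : ℤ} (hσ : σ = 1 ∨ σ = -1) (hx : 0 < x) (hε : 0 < ε)
    (hu : 0 < u) : shellWeight c x ε σ (shell x ε σ u) = mu c u := by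
  rw [shellWeight]
  have hσσ : (σ : ℝ) * σ = 1 := by rcases hσ with rfl | rfl <;> norm_num
  split_ifs with h
  · rw [abs_log_div_of_eq hσ hx hε hu, mul_div_cancel_left₀ _ hε.ne']
    rw [shell, ← mul_assoc, hσσ, one_mul]
  · rw [(strictMono_shell hx hε hσ).lt_iff_lt, not_lt] at h
    exact (mu_eq_zero h).symm

/-- The cutoff is needed for σ = -1: past the end point t may become positive, and the logarithm,
which ignores signs, would give nonzero values near t = x. -/
theorem shellWeight_eq_zero {c x ε t : ℝ} {σ : ℤ} (ht : shell x ε σ 1 ≤ t) :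
    shellWeight c x ε σ t = 0 := by
  rw [shellWeight, if_neg ht.not_gt]

theorem shellWeight_nonneg {c x ε α t : ℝ} {σ : ℤ} (hσ : σ = 1 ∨ σ = -1) (hc : 0 < c) (hx : 0 < x)
    (hε : 0 < ε) (hα : 0 < α) (hα1 : α ≤ 1) (ht : shell x ε σ α ≤ t) :
    0 ≤ shellWeight c x ε σ t := by
  rcases le_or_gt (shell x ε σ 1) t with h | h
  · rw [shellWeight_eq_zero h]
  · obtain ⟨u, h1, h2, rfl⟩ := exists_shell_eq hα1 ht h.le
    rw [shellWeight_shell hσ hx hε (hα.trans_le h1)]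
    exact mu_nonneg hc (hα.trans_le h1)

theorem shellWeight_antitoneOn {c x ε α : ℝ} {σ : ℤ} (hσ : σ = 1 ∨ σ = -1) (hc : 0 < c)
    (hx : 0 < x) (hε : 0 < ε) (hα : 0 < α) (hα1 : α ≤ 1) :
    AntitoneOn (shellWeight c x ε σ) (Set.Ici (shell x ε σ α)) := by
  intro s hs t ht hst
  rcases le_or_gt (shell x ε σ 1) t with h | h
  · rw [shellWeight_eq_zero h]
    exact shellWeight_nonneg hσ hc hx hε hα hα1 hs
  · obtain ⟨v, h1, h2, rfl⟩ := exists_shell_eq hα1 ht h.le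
    obtain ⟨u, h3, h4, rfl⟩ := exists_shell_eq hα1 hs (hst.trans h.le)
    rw [shellWeight_shell hσ hx hε (hα.trans_le h1),
      shellWeight_shell hσ hx hε (hα.trans_le h3)]
    exact mu_antitoneOn hc (hα.trans_le h3) (hα.trans_le h1)
      ((strictMono_shell hx hε hσ).le_iff_le.1 hst)

/-- Substituting t = `shell x ε σ u` gives the Jacobian εx·e^{σεu} ≤ εx·e^ε, and the integral of μ_c
over [α, 1] is |ν_c(α)|. -/
theorem integral_shellWeight_le {c x ε α : ℝ} {σ : ℤ} (hσ : σ = 1 ∨ σ = -1) (hc : 0 < c)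
    (hx : 0 < x) (hε : 0 < ε) (hα : 0 < α) (hα1 : α ≤ 1) :
    ∫ t in shell x ε σ α..shell x ε σ 1, shellWeight c x ε σ t ≤
      ε * x * Real.exp ε * |nu c α| := by
  have hmono := strictMono_shell hx hε hσ
  have himg : shell x ε σ '' Set.Icc α 1 = Set.Icc (shell x ε σ α) (shell x ε σ 1) := by
    ext t
    constructor
    · rintro ⟨u, hu, rfl⟩
      exact ⟨hmono.monotone hu.1, hmono.monotone hu.2⟩
    · rintro ⟨h1, h2⟩
      obtain ⟨u, h3, h4, rfl⟩ := exists_shell_eq hα1 h1 h2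
      exact ⟨u, ⟨h3, h4⟩, rfl⟩
  rw [intervalIntegral.integral_of_le (hmono.monotone hα1), ← integral_Icc_eq_integral_Ioc, ← himg,
    integral_image_eq_integral_abs_deriv_smul measurableSet_Icc
      (fun u _ => (hasDerivAt_shell x ε hσ u).hasDerivWithinAt) hmono.injective.injOn,
    abs_nu_eq hc hα hα1, intervalIntegral.integral_of_le hα1, ← integral_Icc_eq_integral_Ioc,
    ← integral_const_mul]
  have hint : IntegrableOn (fun u => ε * x * Real.exp ε * mu c u) (Set.Icc α 1) :=
    ((integrable_mu hc).const_mul _).integrableOn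
  have hval : ∀ u ∈ Set.Icc α 1, |ε * x * Real.exp (σ * (ε * u))| •
      shellWeight c x ε σ (shell x ε σ u) = ε * x * Real.exp (σ * (ε * u)) * mu c u := by
    intro u hu
    rw [shellWeight_shell hσ hx hε (hα.trans_le hu.1), abs_of_pos (by positivity),
      smul_eq_mul]
  rw [setIntegral_congr_fun measurableSet_Icc hval]
  refine integral_mono_of_nonneg ?_ hint ?_
  · filter_upwards [ae_restrict_mem measurableSet_Icc] with u hu
    have := mu_nonneg hc (hα.trans_le hu.1)
    simp only [Pi.zero_apply]
    positivity
  · filter_upwards [ae_restrict_mem measurableSet_Icc] with u hu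
    have h1 := mu_nonneg hc (hα.trans_le hu.1)
    have h2 : (σ : ℝ) * (ε * u) ≤ ε := by
      have h3 : 0 < ε * u := mul_pos hε (hα.trans_le hu.1)
      have h4 : ε * u ≤ ε := mul_le_of_le_one_right hε.le hu.2
      rcases hσ with rfl | rfl <;> push_cast <;> linarith
    have h5 := Real.exp_le_exp.2 h2
    gcongr

theorem coprime_six_of_prime {p : ℕ} (hp : p.Prime) (h5 : 5 ≤ p) : p.Coprime 6 := by
  rw [hp.coprime_iff_not_dvd]
  intro h
  have h6 := Nat.le_of_dvd (by norm_num) h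
  interval_cases p <;> revert hp h <;> norm_num

theorem sum_primes_mu_le {c x ε α : ℝ} {σ : ℤ} (hσ : σ = 1 ∨ σ = -1) (hc : 0 < c)
    (hx : 0 < x) (hε : 0 < ε) (hα : 0 < α) (hα1 : α ≤ 1) {z : ℕ} (hz : 1 < z) (P : Finset ℕ)
    (hP : ∀ p ∈ P, p.Prime ∧ z ≤ p ∧ 5 ≤ p ∧ shell x ε σ α ≤ σ * p ∧ σ * p ≤ shell x ε σ 1) :
    ∑ p ∈ P, mu c (|Real.log (p / x)| / ε) ≤
      ε * x * Real.exp ε * |nu c α| / 3 / selbergSum z +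
        2 * mu c α * (sigmaSum z / selbergSum z) ^ 2 := by
  have hmono := strictMono_shell hx hε hσ
  have hL := selbergSum_pos hz
  have hσσ : σ * σ = 1 := by rcases hσ with rfl | rfl <;> norm_num
  let N : ℕ := ⌊x * Real.exp ε⌋₊
  have hN : ∀ k : ℕ, shell x ε σ α ≤ σ * k → σ * k ≤ shell x ε σ 1 → k ≤ N := by
    intro k h1 h2
    obtain ⟨u, h3, h4, h5⟩ := exists_shell_eq hα1 h1 h2
    rw [shell_eq_iff hσ] at h5
    refine Nat.le_floor ?_
    rw [h5]
    have h6 : (σ : ℝ) * (ε * u) ≤ ε := by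
      have h7 : 0 < ε * u := mul_pos hε (hα.trans_le h3)
      have h8 : ε * u ≤ ε := mul_le_of_le_one_right hε.le h4
      rcases hσ with rfl | rfl <;> push_cast <;> linarith
    have := Real.exp_le_exp.2 h6
    gcongr
  have hpos : ∀ n : ℤ, shell x ε σ α ≤ n → n ≤ shell x ε σ 1 → 0 ≤ σ * n := by
    intro n h1 h2
    obtain ⟨u, h3, h4, h5⟩ := exists_shell_eq hα1 h1 h2
    have h6 : (n : ℝ) = σ * ((σ * n : ℤ) : ℝ) := by
      rw [← Int.cast_mul, ← mul_assoc, hσσ, one_mul]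
    rw [h6, shell_eq_iff hσ] at h5
    have h7 : (0 : ℝ) ≤ ((σ * n : ℤ) : ℝ) := by
      rw [h5]
      positivity
    exact_mod_cast h7
  classical
  -- For σ = -1 this also admits integers below the interval; their weight is 0.
  set A : Finset ℕ := {n ∈ range (N + 1) | shell x ε σ α ≤ σ * n ∧ n.Coprime 6} with hA
  have h := sum_primes_le_of_antitone hz hσ (g := shellWeight c x ε σ) (hmono.monotone hα1)
    (shellWeight_antitoneOn hσ hc hx hε hα hα1)
    (fun t ht => shellWeight_nonneg hσ hc hx hε hα hα1 ht) (fun t ht => shellWeight_eq_zero ht) A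
    (fun n hn => (mem_filter.1 hn).2) (fun n h6 h1 h2 => by
      have h3 := hpos n h1 h2
      have h4 : σ * ((σ * n).toNat : ℤ) = n := by
        rw [Int.toNat_of_nonneg h3, ← mul_assoc, hσσ, one_mul]
      have h5 : (σ : ℝ) * ((σ * n).toNat : ℝ) = n := by exact_mod_cast congrArg (Int.cast (R := ℝ)) h4
      have h7 : IsCoprime ((σ * n).toNat : ℤ) 6 := by
        rw [← h4] at h6
        exact h6.of_mul_left_right
      refine ⟨(σ * n).toNat, mem_filter.2 ⟨mem_range.2 (Nat.lt_succ_of_le (hN _ ?_ ?_)), ?_, ?_⟩,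
        h4⟩
      · rw [h5]; exact h1
      · rw [h5]; exact h2
      · rw [h5]; exact h1
      · exact Nat.isCoprime_iff_coprime.1 (by exact_mod_cast h7))
  rw [shellWeight_shell hσ hx hε hα] at h
  have h1 : ∑ p ∈ P, mu c (|Real.log (p / x)| / ε) = ∑ p ∈ P, shellWeight c x ε σ (σ * p) := by
    refine sum_congr rfl fun p hp => ?_
    obtain ⟨-, -, -, h2, h3⟩ := hP p hp
    obtain ⟨u, h4, h5, h6⟩ := exists_shell_eq hα1 h2 h3
    have hu := hα.trans_le h4
    rw [← h6, shellWeight_shell hσ hx hε hu,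
      abs_log_div_of_eq hσ hx hε hu ((shell_eq_iff hσ).1 h6), mul_div_cancel_left₀ _ hε.ne']
  have h2 : ∑ p ∈ P, shellWeight c x ε σ (σ * p) ≤
      ∑ n ∈ A with n.Prime ∧ z ≤ n, shellWeight c x ε σ (σ * n) := by
    refine sum_le_sum_of_subset_of_nonneg (fun p hp => ?_) fun n hn _ =>
      shellWeight_nonneg hσ hc hx hε hα hα1 (mem_filter.1 (mem_filter.1 hn).1).2.1
    obtain ⟨h3, h4, h5, h6, h7⟩ := hP p hp
    exact mem_filter.2 ⟨mem_filter.2 ⟨mem_range.2 (Nat.lt_succ_of_le (hN p h6 h7)), h6,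
      coprime_six_of_prime h3 h5⟩, h3, h4⟩
  have h3 := integral_shellWeight_le hσ hc hx hε hα hα1
  have h4 : (∫ t in shell x ε σ α..shell x ε σ 1, shellWeight c x ε σ t) / 3 / selbergSum z ≤
      ε * x * Real.exp ε * |nu c α| / 3 / selbergSum z := by gcongr
  rw [h1]
  linarith

end OuterIntervals

/-! ### Primes and higher powers combined. -/

section Assembly

open Finset

/-- B carries e^{-ε} while the sieve mass carries e^ε, so the normalized mass y is at least 2B. The
excess y - 2B costs 1/(3L) per unit in the sieve bound, at most the 2/log B allowed, by log B ≤ 6L.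
-/
theorem main_term_le {x c ε α : ℝ} (hx : 0 < x) (hε : 0 < ε) (hmu : 0 < mu c α)
    (hB : 1 < sieveB x c ε α) {z : ℕ} (hz : 1 < z)
    (h1 : Real.log (sieveB x c ε α) ≤ 6 * selbergSum z)
    (h2 : 2 * sieveB x c ε α / 3 / selbergSum z + 2 * (sigmaSum z / selbergSum z) ^ 2 ≤
      4 * sieveB x c ε α / Real.log (sieveB x c ε α)) :
    ε * x * Real.exp ε * |nu c α| / 3 / selbergSum z +
        2 * mu c α * (sigmaSum z / selbergSum z) ^ 2 ≤
      2 * ε * x * Real.exp ε * |nu c α| / Real.log (sieveB x c ε α) := by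
  set B := sieveB x c ε α with hBdef
  have hL := selbergSum_pos hz
  have hlog : 0 < Real.log B := Real.log_pos hB
  set y := ε * x * Real.exp ε * |nu c α| / mu c α with hy
  have hyB : 2 * B ≤ y := by
    have h3 : 2 * B = ε * x * Real.exp (-ε) * |nu c α| / mu c α := by
      rw [hBdef, sieveB]
      field_simp
    rw [h3, hy]
    have : Real.exp (-ε) ≤ Real.exp ε := Real.exp_le_exp.2 (by linarith)
    gcongr
  have hX : ε * x * Real.exp ε * |nu c α| = mu c α * y := by
    rw [hy]
    field_simp
  have h4 : (y - 2 * B) * (1 / (3 * selbergSum z)) ≤ (y - 2 * B) * (2 / Real.log B) := by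
    refine mul_le_mul_of_nonneg_left ?_ (by linarith)
    rw [div_le_div_iff₀ (by positivity) hlog]
    linarith
  have h5 : y / 3 / selbergSum z + 2 * (sigmaSum z / selbergSum z) ^ 2 ≤ 2 * y / Real.log B := by
    have e1 : y / 3 / selbergSum z =
        2 * B / 3 / selbergSum z + (y - 2 * B) * (1 / (3 * selbergSum z)) := by
      field_simp
      ring
    have e2 : 2 * y / Real.log B = 4 * B / Real.log B + (y - 2 * B) * (2 / Real.log B) := by
      field_simp
      ring
    linarith
  calc _ = mu c α * (y / 3 / selbergSum z + 2 * (sigmaSum z / selbergSum z) ^ 2) := by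
        rw [hX]
        ring
    _ ≤ mu c α * (2 * y / Real.log B) := by gcongr
    _ = _ := by
      rw [show 2 * ε * x * Real.exp ε * |nu c α| = 2 * (mu c α * y) by rw [← hX]; ring]
      ring

theorem mu_pos_of_one_lt_sieveB {x c ε α : ℝ} (hc : 0 < c) (hα : 0 < α)
    (hB : 1 < sieveB x c ε α) : 0 < mu c α := by
  refine lt_of_le_of_ne (mu_nonneg hc hα) fun h => ?_
  -- Division by zero yields 0, so B > 1 excludes μ_c(α) = 0.
  rw [sieveB, ← h, mul_zero, div_zero] at hB
  linarith

theorem eps_pos_of_one_lt_sieveB {x c ε α : ℝ} (hx : 0 < x) (hc : 0 < c) (hα : 0 < α)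
    (hB : 1 < sieveB x c ε α) : 0 < ε := by
  by_contra! h
  have hmu := mu_pos_of_one_lt_sieveB hc hα hB
  have h1 : sieveB x c ε α ≤ 0 := by
    refine div_nonpos_of_nonpos_of_nonneg ?_ (by positivity)
    exact mul_nonpos_of_nonpos_of_nonneg (mul_nonpos_of_nonpos_of_nonneg
      (mul_nonpos_of_nonpos_of_nonneg h hx.le) (Real.exp_pos _).le) (abs_nonneg _)
  linarith

theorem sieveB_le {x c ε α : ℝ} (hx : 0 < x) (hc : 0 < c) (hε : 0 < ε) (hα : 0 < α) (hα1 : α ≤ 1)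
    (hmu : 0 < mu c α) : sieveB x c ε α ≤ ε / 2 * (x * Real.exp (-ε)) := by
  have h1 : |nu c α| ≤ mu c α :=
    (abs_nu_le hc hα hα1).trans (mul_le_of_le_one_left hmu.le (by linarith))
  rw [sieveB, div_le_iff₀ (by positivity)]
  calc ε * x * Real.exp (-ε) * |nu c α| ≤ ε * x * Real.exp (-ε) * mu c α := by gcongr
    _ = _ := by ring

theorem primePowerSum_outer_le {x ε c α : ℝ} {σ : ℤ} (hσ : σ = 1 ∨ σ = -1) {I : Set ℝ}
    (hI : ∀ t, t ∈ I ↔ shell x ε σ α ≤ σ * t ∧ σ * t ≤ shell x ε σ 1)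
    (hx : 100 ≤ x) (hε1 : ε ≤ 0.01) (hc : 0 < c) (hα : 0 < α) (hα1 : α ≤ 1)
    (hB : 1 < sieveB x c ε α) :
    |primePowerSum I (weightM x c ε)| ≤
      2 * ε * x * Real.exp (2 * ε) * |nu c α| / Real.log (sieveB x c ε α) +
        Real.exp ε * mu c α * (4.01 * ε * √x + Real.log (Real.log (2 * x ^ 2))) := by
  have hx0 : 0 < x := by linarith
  have hmu := mu_pos_of_one_lt_sieveB hc hα hB
  have hε := eps_pos_of_one_lt_sieveB hx0 hc hα hB
  have hε1' : ε ≤ 1 / 100 := by norm_num at hε1; exact hε1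
  have hmem : ∀ t ∈ I, ∃ u, α ≤ u ∧ u ≤ 1 ∧ t = x * Real.exp (σ * (ε * u)) := by
    intro t ht
    obtain ⟨u, h1, h2, h3⟩ := exists_shell_eq hα1 ((hI t).1 ht).1 ((hI t).1 ht).2
    exact ⟨u, h1, h2, (shell_eq_iff hσ).1 h3⟩
  have hexp : ∀ u, α ≤ u → u ≤ 1 → -ε ≤ σ * (ε * u) ∧ σ * (ε * u) ≤ ε := by
    intro u h1 h2
    have h3 : 0 < ε * u := mul_pos hε (hα.trans_le h1)
    have h4 : ε * u ≤ ε := mul_le_of_le_one_right hε.le h2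
    rcases hσ with rfl | rfl <;> push_cast <;> constructor <;> linarith
  have hlow : ∀ t ∈ I, x * Real.exp (-ε) ≤ t := by
    intro t ht
    obtain ⟨u, h1, h2, rfl⟩ := hmem t ht
    have := Real.exp_le_exp.2 (hexp u h1 h2).1
    gcongr
  have hupp : ∀ t ∈ I, t ≤ x * Real.exp ε := by
    intro t ht
    obtain ⟨u, h1, h2, rfl⟩ := hmem t ht
    have := Real.exp_le_exp.2 (hexp u h1 h2).2
    gcongr
  have hδ : Real.exp ε ≤ 1 + 2 * ε := by
    have := Real.abs_exp_sub_one_le (x := ε) (by rw [abs_of_pos hε]; linarith)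
    rw [abs_of_pos hε] at this
    linarith [le_abs_self (Real.exp ε - 1)]
  have hratio : ∀ t ∈ I, ∀ t' ∈ I, t' ≤ (1 + 2 * ε) * t := by
    intro t ht t' ht'
    obtain ⟨u, h1, h2, rfl⟩ := hmem t ht
    obtain ⟨v, h3, h4, rfl⟩ := hmem t' ht'
    have h5 : (σ : ℝ) * (ε * v) ≤ ε + σ * (ε * u) := by
      have h6 : 0 ≤ ε * (1 + u - v) := mul_nonneg hε.le (by linarith)
      have h7 : 0 ≤ ε * (1 + v - u) := mul_nonneg hε.le (by linarith)
      rcases hσ with rfl | rfl <;> push_cast <;> linarith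
    calc x * Real.exp (σ * (ε * v)) ≤ x * Real.exp (ε + σ * (ε * u)) := by gcongr
      _ = Real.exp ε * (x * Real.exp (σ * (ε * u))) := by rw [Real.exp_add]; ring
      _ ≤ _ := by gcongr
  have hx99 : 99 ≤ x * Real.exp (-ε) := by
    have := Real.add_one_le_exp (-ε)
    nlinarith
  set W : ℝ → ℝ := fun t => mu c (|Real.log (t / x)| / ε) with hW
  have hWt : ∀ t ∈ I, 0 ≤ W t ∧ W t ≤ mu c α ∧ |weightM x c ε t| ≤ Real.exp ε * W t := by
    intro t ht
    obtain ⟨u, h1, h2, h3⟩ := hmem t ht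
    have hu := hα.trans_le h1
    have habs := abs_log_div_of_eq hσ hx0 hε hu h3
    have hWu : W t = mu c u := by
      simp only [hW]
      rw [habs, mul_div_cancel_left₀ _ hε.ne']
    have hlogt : 2 ≤ Real.log t := by
      have h5 : Real.log (2 ^ 6) ≤ Real.log t :=
        Real.log_le_log (by norm_num) (by linarith [hlow t ht])
      rw [Real.log_pow] at h5
      have := Real.log_two_gt_d9
      push_cast at h5
      linarith
    rw [hWu]
    have h4 := mu_nonneg hc hu
    refine ⟨h4, mu_antitoneOn hc hα hu h1, (abs_weightM_le hc hε hlogt hu h2 habs).trans ?_⟩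
    have := Real.add_one_le_exp ε
    gcongr
    linarith
  have hbdd : BddAbove I := ⟨_, fun t ht => hupp t ht⟩
  set T := (primePowerPairs_finite hbdd).toFinset with hT
  have hTmem : ∀ q ∈ T, q.1.Prime ∧ 1 ≤ q.2 ∧ (q.1 : ℝ) ^ q.2 ∈ I := by
    intro q hq
    exact (primePowerPairs_finite hbdd).mem_toFinset.1 hq
  have hsum : |primePowerSum I (weightM x c ε)| ≤
      Real.exp ε * ∑ q ∈ T, 1 / (q.2 : ℝ) * W ((q.1 : ℝ) ^ q.2) := by
    rw [primePowerSum, finsum_mem_eq_finite_toFinset_sum _ (primePowerPairs_finite hbdd), mul_sum]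
    refine (abs_sum_le_sum_abs _ _).trans (sum_le_sum fun q hq => ?_)
    rw [abs_mul, abs_of_nonneg (by positivity : (0 : ℝ) ≤ 1 / (q.2 : ℝ)), mul_left_comm]
    exact mul_le_mul_of_nonneg_left (hWt _ (hTmem q hq).2.2).2.2 (by positivity)
  have hsplit := sum_filter_add_sum_filter_not T (fun q => q.2 = 1)
    (fun q => 1 / (q.2 : ℝ) * W ((q.1 : ℝ) ^ q.2))
  have hprimes : ∑ q ∈ T with q.2 = 1, 1 / (q.2 : ℝ) * W ((q.1 : ℝ) ^ q.2) ≤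
      2 * ε * x * Real.exp ε * |nu c α| / Real.log (sieveB x c ε α) := by
    obtain ⟨z, hz, hzB, h1, h2⟩ := exists_sieve_level hB
    refine le_trans ?_ (main_term_le hx0 hε hmu hB hz h1 h2)
    have hBle := sieveB_le hx0 hc hε hα hα1 hmu
    -- z ≤ B + 1 and B ≤ (ε/2)·x·e^{-ε} is far below the interval, so no prime in it is lost to the
    -- condition p ≥ z.
    have hzle : (z : ℝ) ≤ x * Real.exp (-ε) := by nlinarith
    set T1 : Finset (ℕ × ℕ) := {q ∈ T | q.2 = 1} with hT1
    have hT1' : ∀ q ∈ T1, q ∈ T ∧ q.2 = 1 := fun q hq => mem_filter.1 hq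
    have hinj : Set.InjOn Prod.fst (T1 : Set (ℕ × ℕ)) := fun q hq q' hq' h =>
      Prod.ext h ((hT1' q hq).2.trans (hT1' q' hq').2.symm)
    have h3 := sum_primes_mu_le hσ hc hx0 hε hα hα1 hz (T1.image Prod.fst) (fun p hp => by
      obtain ⟨q, hq, rfl⟩ := mem_image.1 hp
      obtain ⟨hq1, hq2⟩ := hT1' q hq
      obtain ⟨h4, -, h5⟩ := hTmem q hq1
      rw [hq2, pow_one] at h5
      have h6 := hlow _ h5
      refine ⟨h4, by exact_mod_cast hzle.trans h6, ?_, (hI _).1 h5⟩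
      have : (5 : ℝ) ≤ q.1 := by linarith
      exact_mod_cast this)
    rw [sum_image hinj] at h3
    refine le_trans (le_of_eq (sum_congr rfl fun q hq => ?_)) h3
    rw [(hT1' q hq).2]
    simp [hW]
  have hx2 : 1 ≤ Real.log (2 * x ^ 2) := by
    rw [Real.le_log_iff_exp_le (by positivity)]
    have := Real.exp_one_lt_d9
    nlinarith
  have hhigher : ∑ q ∈ T with ¬q.2 = 1, 1 / (q.2 : ℝ) * W ((q.1 : ℝ) ^ q.2) ≤
      mu c α * (4.01 * ε * √x + Real.log (Real.log (2 * x ^ 2))) := by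
    set T2 : Finset (ℕ × ℕ) := {q ∈ T | ¬q.2 = 1} with hT2
    have hT2' : ∀ q ∈ T2, q ∈ T ∧ ¬q.2 = 1 := fun q hq => mem_filter.1 hq
    -- An exponent m satisfies 2^m ≤ 2x, and log(2x)/log 2 ≤ log(2x²) since x ≥ 2.
    set M := ⌊Real.log (2 * x ^ 2)⌋₊ with hM
    have hM1 : 1 ≤ M := Nat.le_floor (by exact_mod_cast hx2)
    have hlogM : Real.log M ≤ Real.log (Real.log (2 * x ^ 2)) :=
      Real.log_le_log (by exact_mod_cast hM1) (Nat.floor_le (by linarith))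
    have h2x : x * Real.exp ε ≤ 2 * x := by nlinarith
    have hbound : ∀ q ∈ T2, 1 ≤ q.1 ∧ 2 ≤ q.2 ∧ q.2 ≤ M ∧ (q.1 : ℝ) ^ q.2 ≤ 4 * x := by
      intro q hq
      obtain ⟨hq1, hq2⟩ := hT2' q hq
      obtain ⟨h4, h5, h6⟩ := hTmem q hq1
      have h7 := (hupp _ h6).trans h2x
      refine ⟨h4.one_lt.le, by omega, Nat.le_floor ?_, by linarith⟩
      have h8 : (2 : ℝ) ^ q.2 ≤ 2 * x :=
        (pow_le_pow_left₀ zero_le_two (by exact_mod_cast h4.two_le) _).trans h7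
      have h9 := Real.log_le_log (by positivity) h8
      rw [Real.log_pow, Real.log_mul two_ne_zero hx0.ne'] at h9
      rw [Real.log_mul two_ne_zero (by positivity), Real.log_pow]
      have h10 : Real.log 2 ≤ Real.log x := Real.log_le_log two_pos (by linarith)
      have h11 := Real.log_two_gt_d9
      have h12 : (0 : ℝ) ≤ q.2 := by positivity
      push_cast
      nlinarith
    -- The choice r = 4x has the simple root 2√x and gives δ√r = 4ε√x, just within the constant
    -- 4.01.
    have h1 := sum_higher_powers_le (δ := 2 * ε) (r := 4 * x) (by positivity) hM1 hbound
      (fun q hq q' hq' => hratio _ (hTmem q (hT2' q hq).1).2.2 _ (hTmem q' (hT2' q' hq').1).2.2)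
    have hsqrt : √(4 * x) = 2 * √x := by
      rw [Real.sqrt_mul (by norm_num), show (4 : ℝ) = 2 ^ 2 by norm_num,
        Real.sqrt_sq zero_le_two]
    calc ∑ q ∈ T2, 1 / (q.2 : ℝ) * W ((q.1 : ℝ) ^ q.2)
        ≤ ∑ q ∈ T2, mu c α * (1 / (q.2 : ℝ)) := by
          refine sum_le_sum fun q hq => ?_
          rw [mul_comm (mu c α)]
          exact mul_le_mul_of_nonneg_left (hWt _ (hTmem q (hT2' q hq).1).2.2).2.1 (by positivity)
      _ = mu c α * ∑ q ∈ T2, 1 / (q.2 : ℝ) := by rw [mul_sum]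
      _ ≤ mu c α * (Real.log M + 2 * ε * √(4 * x)) := by gcongr
      _ ≤ _ := by
          rw [hsqrt]
          have h13 : 0 ≤ ε * √x := by positivity
          refine mul_le_mul_of_nonneg_left ?_ hmu.le
          have h14 : 2 * ε * (2 * √x) ≤ 4.01 * ε * √x := by
            norm_num1
            linarith
          linarith
  refine hsum.trans ?_
  rw [← hsplit]
  have hexp2 : Real.exp (2 * ε) = Real.exp ε * Real.exp ε := by rw [← Real.exp_add]; ring_nf
  calc _ ≤ Real.exp ε * (2 * ε * x * Real.exp ε * |nu c α| / Real.log (sieveB x c ε α) +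
        mu c α * (4.01 * ε * √x + Real.log (Real.log (2 * x ^ 2)))) := by gcongr
    _ = _ := by
      rw [hexp2]
      ring

end Assembly

end LoganSieve

end

theorem proposition4 (x ε c α : ℝ) (hx : 100 ≤ x) (hε : ε ≤ 0.01) (hc : 1 ≤ c)
    (hα0 : 0 < α) (hα1 : α < 1) (hB : 1 < LoganSieve.sieveB x c ε α) :
    |LoganSieve.primePowerSum (LoganSieve.outerPlus x ε α) (LoganSieve.weightM x c ε)| ≤
        2 * ε * x * Real.exp (2 * ε) * |LoganSieve.nu c α| / Real.log (LoganSieve.sieveB x c ε α) +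
          Real.exp ε * LoganSieve.mu c α *
            (4.01 * ε * √x + Real.log (Real.log (2 * x ^ 2))) ∧
      |LoganSieve.primePowerSum (LoganSieve.outerMinus x ε α) (LoganSieve.weightM x c ε)| ≤
        2 * ε * x * Real.exp (2 * ε) * |LoganSieve.nu c α| / Real.log (LoganSieve.sieveB x c ε α) +
          Real.exp ε * LoganSieve.mu c α *
            (4.01 * ε * √x + Real.log (Real.log (2 * x ^ 2))) := by
  have hc0 : 0 < c := by linarith
  refine ⟨LoganSieve.primePowerSum_outer_le (Or.inl rfl) (fun t => ?_) hx hε hc0 hα0 hα1.le hB,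
    LoganSieve.primePowerSum_outer_le (Or.inr rfl) (fun t => ?_) hx hε hc0 hα0 hα1.le hB⟩
  · simp only [LoganSieve.outerPlus, LoganSieve.shell, Set.mem_Icc, Int.cast_one, one_mul,
      mul_comm x, mul_comm ε]
  · simp only [LoganSieve.outerMinus, LoganSieve.shell, Set.mem_Icc, Int.cast_neg, Int.cast_one,
      neg_mul, one_mul, neg_le_neg_iff, mul_comm x, mul_comm ε]
    exact and_comm
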